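/- Let $\mathfrak V$ be the complex Virasoro algebra, with basis $\{c, l_i : i\in\mathbb Z\}$ and bracket $[l_i,l_j]=(j-i)\,l_{i+j}+\delta_{i,-j}\frac{i^3-i}{12}\,c$, $[l_i,c]=0$. Let $\mathfrak V_+$ be the Lie subalgebra spanned by all $l_i$ with $i\ge 0$ and, for an integer $n\ge 0$, let $\mathfrak V_+^{(n)}$ be the Lie subalgebra generated by all $l_i$ with $i>n$. A module $V$ over a Lie algebra $\mathfrak a$ is locally finite if every $v\in V$ lies in a finite-dimensional $\mathfrak a$-submodule, and locally nilpotent if for every $v\in V$ there is $n\ge 1$ with $a_1a_2\cdots a_n v=0$ for all $a_1,\dots,a_n\in\mathfrak a$. An element $x\in\mathfrak a$ acts locally nilpotently on $V$ if for every $v\in V$ there is $n$ with $x^nv=0$. A highest weight module is a $\mathfrak V$-module generated by a nonzero vector that is annihilated by all $l_i$ with $i>0$ and on which $l_0$ and $c$ act by scalars. For a $\mathfrak V_+$-module $N$ and $\theta\in\mathbb C$ put $\mathrm{Ind}(N)=U(\mathfrak V)\otimes_{U(\mathfrak V_+)}N$ and $\mathrm{Ind}_\theta(N)=\mathrm{Ind}(N)/(c-\theta)\mathrm{Ind}(N)$.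 Theorem. Let $L$ be a simple $\mathfrak V$-module. The following conditions are equivalent: (a) there is an integer $k\ge 1$ such that $L$ is a locally finite $\mathfrak V_+^{(k)}$-module; (b) there is an integer $n\ge 1$ such that $L$ is a locally nilpotent $\mathfrak V_+^{(n)}$-module; (c) $L$ is a highest weight module, or there are $\theta\in\mathbb C$, an integer $k\ge 1$ and a simple $\mathfrak V_+$-module $N$ such that $l_k$ acts injectively on $N$, $l_iN=0$ for all $i>k$, and $L\cong\mathrm{Ind}_\theta(N)$. Moreover, suppose that these conditions hold, and that the least integer $k\ge 0$ such that $l_i$ acts locally nilpotently on $L$ for every $i>k$ is positive. Put $N=\{v\in L : l_iv=0 \text{ for all } i>k\}$. Then $N$ is a simple $\mathfrak V_+$-module on which $l_k$ acts injectively and $l_i$ acts by zero for all $i>k$, the element $c$ acts on $L$ by a scalar $\theta$, and the canonical homomorphism $\mathrm{Ind}_\theta(N)\to L$ with $1\otimes x\mapsto x$ for $x\in N$ is an isomorphism of $\mathfrak V$-modules. -/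

import Mathlib

open scoped TensorProduct

universe u

attribute [local instance] LieRing.ofAssociativeRing

/-! ### The Virasoro algebra -/

/-- The underlying space of the complex Virasoro algebra, with basis `l i` (`i : ℤ`) and `c`;
the pair `(f, a)` stands for `∑ i, f i • l i + a • c`. -/
def Virasoro : Type := (ℤ →₀ ℂ) × ℂ

namespace Virasoro

noncomputable instance : AddCommGroup Virasoro := inferInstanceAs (AddCommGroup ((ℤ →₀ ℂ) × ℂ))

noncomputable instance : Module ℂ Virasoro := inferInstanceAs (Module ℂ ((ℤ →₀ ℂ) × ℂ))

/-- The basis element `l i`. -/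
noncomputable def l (i : ℤ) : Virasoro := (Finsupp.single i 1, 0)

/-- The central element `c`. -/
noncomputable def c : Virasoro := (0, 1)

/-- The projection that forgets the coefficient of `c`. -/
noncomputable def fstₗ : Virasoro →ₗ[ℂ] (ℤ →₀ ℂ) := LinearMap.fst ℂ (ℤ →₀ ℂ) ℂ

/-- The bracket as a bilinear map: on basis elements,
`[l i, l j] = (j - i) l (i + j) + δ_{i,-j} (i ^ 3 - i) / 12 c`, and `c` is central. -/
noncomputable def bracketₗ : Virasoro →ₗ[ℂ] Virasoro →ₗ[ℂ] Virasoro :=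
  (Finsupp.linearCombination ℂ (fun i : ℤ => Finsupp.linearCombination ℂ (fun j : ℤ =>
    ((j : ℂ) - (i : ℂ)) • l (i + j) +
      (if i = -j then ((i : ℂ) ^ 3 - (i : ℂ)) / 12 else 0) • c))).compl₁₂ fstₗ fstₗ

noncomputable instance : Bracket Virasoro Virasoro := ⟨fun x y => bracketₗ x y⟩

theorem bracket_def (x y : Virasoro) : ⁅x, y⁆ = bracketₗ x y := rfl

@[simp] theorem fstₗ_l (i : ℤ) : fstₗ (l i) = Finsupp.single i 1 := rfl

@[simp] theorem fstₗ_c : fstₗ c = 0 := rfl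

theorem bracketₗ_l_l (i j : ℤ) : bracketₗ (l i) (l j) = ((j : ℂ) - (i : ℂ)) • l (i + j) +
    (if i = -j then ((i : ℂ) ^ 3 - (i : ℂ)) / 12 else 0) • c := by
  simp [bracketₗ]

theorem bracketₗ_c_left (x : Virasoro) : bracketₗ c x = 0 := by
  simp [bracketₗ]

theorem bracketₗ_c_right (x : Virasoro) : bracketₗ x c = 0 := by
  simp [bracketₗ]

theorem span_basis : Submodule.span ℂ (Set.range l ∪ {c}) = ⊤ := by
  let s : (ℤ →₀ ℂ) →ₗ[ℂ] Virasoro := LinearMap.inl ℂ (ℤ →₀ ℂ) ℂ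
  have hs : ∀ f, s f ∈ Submodule.span ℂ (Set.range l ∪ {c}) := by
    intro f
    induction f using Finsupp.induction_linear with
    | zero => rw [map_zero]; exact Submodule.zero_mem _
    | add f g hf hg => rw [map_add]; exact Submodule.add_mem _ hf hg
    | single i b =>
      rw [← mul_one b, ← smul_eq_mul, ← Finsupp.smul_single, map_smul]
      exact Submodule.smul_mem _ _ (Submodule.subset_span (Or.inl ⟨i, rfl⟩))
  refine Submodule.eq_top_iff'.2 fun x => ?_
  have hx : x = s x.1 + x.2 • c := Prod.ext
    (by exact (by simp : x.1 = x.1 + x.2 • (0 : ℤ →₀ ℂ)))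
    (by exact (by simp : x.2 = 0 + x.2 • (1 : ℂ)))
  rw [hx]
  exact Submodule.add_mem _ (hs _)
    (Submodule.smul_mem _ _ (Submodule.subset_span (Or.inr rfl)))

theorem induction_basis {p : Virasoro → Prop} (hl : ∀ i, p (l i)) (hc : p c) (h0 : p 0)
    (hadd : ∀ x y, p x → p y → p (x + y)) (hsmul : ∀ (a : ℂ) x, p x → p (a • x))
    (x : Virasoro) : p x := by
  have hx : x ∈ Submodule.span ℂ (Set.range l ∪ {c}) := by rw [span_basis]; trivial
  induction hx using Submodule.span_induction with
  | mem x hx =>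
    rcases hx with ⟨i, rfl⟩ | rfl
    · exact hl i
    · exact hc
  | zero => exact h0
  | add x y _ _ hx hy => exact hadd x y hx hy
  | smul a x _ hx => exact hsmul a x hx

theorem bracketₗ_skew (x y : Virasoro) : bracketₗ x y + bracketₗ y x = 0 := by
  induction x using induction_basis with
  | hc => simp [bracketₗ_c_left, bracketₗ_c_right]
  | h0 => simp
  | hadd x x' hx hx' =>
    have h : bracketₗ (x + x') y + bracketₗ y (x + x') =
        (bracketₗ x y + bracketₗ y x) + (bracketₗ x' y + bracketₗ y x') := by
      simp only [map_add, LinearMap.add_apply]; abel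
    rw [h, hx, hx', add_zero]
  | hsmul a x hx =>
    rw [map_smul, map_smul, LinearMap.smul_apply, ← smul_add, hx, smul_zero]
  | hl i =>
    induction y using induction_basis with
    | hc => simp [bracketₗ_c_left, bracketₗ_c_right]
    | h0 => simp
    | hadd y y' hy hy' =>
      have h : bracketₗ (l i) (y + y') + bracketₗ (y + y') (l i) =
          (bracketₗ (l i) y + bracketₗ y (l i)) + (bracketₗ (l i) y' + bracketₗ y' (l i)) := by
        simp only [map_add, LinearMap.add_apply]; abel
      rw [h, hy, hy', add_zero]
    | hsmul a y hy =>
      rw [map_smul, map_smul, LinearMap.smul_apply, ← smul_add, hy, smul_zero]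
    | hl j =>
      rw [bracketₗ_l_l, bracketₗ_l_l, add_comm j i]
      by_cases h : i = -j
      · have h' : j = -i := by lia
        rw [if_pos h, if_pos h']
        subst h
        push_cast
        module
      · have h' : ¬ j = -i := by lia
        rw [if_neg h, if_neg h']
        module

theorem bracketₗ_self (x : Virasoro) : bracketₗ x x = 0 := by
  have h := bracketₗ_skew x x
  rw [← two_smul ℂ] at h
  exact (smul_eq_zero.1 h).resolve_left two_ne_zero

theorem bracketₗ_jacobi (x y z : Virasoro) :
    bracketₗ x (bracketₗ y z) = bracketₗ (bracketₗ x y) z + bracketₗ y (bracketₗ x z) := by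
  induction x using induction_basis with
  | hc => simp [bracketₗ_c_left]
  | h0 => simp
  | hadd x x' hx hx' => simp only [map_add, LinearMap.add_apply, hx, hx']; abel
  | hsmul a x hx => simp only [map_smul, LinearMap.smul_apply, hx, smul_add]
  | hl i =>
    induction y using induction_basis with
    | hc => simp [bracketₗ_c_left, bracketₗ_c_right]
    | h0 => simp
    | hadd y y' hy hy' => simp only [map_add, LinearMap.add_apply, hy, hy']; abel
    | hsmul a y hy => simp only [map_smul, LinearMap.smul_apply, hy, smul_add]
    | hl j =>
      induction z using induction_basis with
      | hc => simp [bracketₗ_c_right]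
      | h0 => simp
      | hadd z z' hz hz' => simp only [map_add, hz, hz']; abel
      | hsmul a z hz => simp only [map_smul, hz, smul_add]
      | hl k =>
        simp only [bracketₗ_l_l, map_add, map_smul, LinearMap.add_apply, LinearMap.smul_apply,
          bracketₗ_c_right, bracketₗ_c_left, smul_zero, add_zero]
        have e1 : i + (j + k) = i + j + k := by ring
        have e2 : j + (i + k) = i + j + k := by ring
        rw [e1, e2]
        by_cases h : i + j + k = 0
        · have h1 : i = -(j + k) := by lia
          have h2 : i + j = -k := by lia
          have h3 : j = -(i + k) := by lia
          rw [if_pos h1, if_pos h2, if_pos h3]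
          have hk : k = -i - j := by lia
          subst hk
          push_cast
          module
        · have h1 : ¬ i = -(j + k) := by lia
          have h2 : ¬ i + j = -k := by lia
          have h3 : ¬ j = -(i + k) := by lia
          rw [if_neg h1, if_neg h2, if_neg h3]
          push_cast
          module

noncomputable instance : LieRing Virasoro where
  add_lie x y z := by simp only [bracket_def, map_add, LinearMap.add_apply]
  lie_add x y z := by simp only [bracket_def, map_add]
  lie_self x := bracketₗ_self x
  leibniz_lie x y z := bracketₗ_jacobi x y z

noncomputable instance : LieAlgebra ℂ Virasoro where
  lie_smul a x y := by simp only [bracket_def, map_smul]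

theorem lie_l_l (i j : ℤ) : ⁅l i, l j⁆ = ((j : ℂ) - (i : ℂ)) • l (i + j) +
    (if i = -j then ((i : ℂ) ^ 3 - (i : ℂ)) / 12 else 0) • c := bracketₗ_l_l i j

/-! ### Subalgebras -/

/-- The subalgebra `𝔙₊` spanned by all `l i` with `i ≥ 0`. -/
noncomputable def plus : LieSubalgebra ℂ Virasoro where
  toSubmodule := Submodule.span ℂ (l '' {i : ℤ | 0 ≤ i})
  lie_mem' := by
    intro x y hx hy
    change x ∈ Submodule.span ℂ (l '' {i : ℤ | 0 ≤ i}) at hx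
    change y ∈ Submodule.span ℂ (l '' {i : ℤ | 0 ≤ i}) at hy
    change ⁅x, y⁆ ∈ Submodule.span ℂ (l '' {i : ℤ | 0 ≤ i})
    induction hx using Submodule.span_induction with
    | zero => rw [zero_lie]; exact Submodule.zero_mem _
    | add x x' _ _ hx hx' => rw [add_lie]; exact Submodule.add_mem _ hx hx'
    | smul a x _ hx => rw [smul_lie]; exact Submodule.smul_mem _ _ hx
    | mem x hx =>
      obtain ⟨i, hi, rfl⟩ := hx
      induction hy using Submodule.span_induction with
      | zero => rw [lie_zero]; exact Submodule.zero_mem _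
      | add y y' _ _ hy hy' => rw [lie_add]; exact Submodule.add_mem _ hy hy'
      | smul a y _ hy => rw [lie_smul]; exact Submodule.smul_mem _ _ hy
      | mem y hy =>
        obtain ⟨j, hj, rfl⟩ := hy
        have hi' : 0 ≤ i := hi
        have hj' : 0 ≤ j := hj
        have h0 : (if i = -j then ((i : ℂ) ^ 3 - (i : ℂ)) / 12 else 0) = 0 := by
          split_ifs with h
          · have : i = 0 := by lia
            simp [this]
          · rfl
        rw [lie_l_l, h0, zero_smul, add_zero]
        exact Submodule.smul_mem _ _
          (Submodule.subset_span ⟨i + j, by change 0 ≤ i + j; lia, rfl⟩)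

/-- The element `l i` of `𝔙₊`, for `i ≥ 0`. -/
noncomputable def lPlus (i : ℕ) : plus :=
  ⟨l (i : ℤ), Submodule.subset_span ⟨(i : ℤ), Int.natCast_nonneg i, rfl⟩⟩

/-- The subalgebra `𝔙₊⁽ⁿ⁾` generated by all `l i` with `i > n`. -/
noncomputable def plusAbove (n : ℕ) : LieSubalgebra ℂ Virasoro :=
  LieSubalgebra.lieSpan ℂ Virasoro (l '' {i : ℤ | (n : ℤ) < i})

end Virasoro

/-! ### Locally finite and locally nilpotent modules -/

/-- A module over a Lie algebra is locally finite if every vector lies in a finite dimensional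
submodule. -/
def IsLocallyFiniteModule (𝔞 : Type*) (V : Type*) [LieRing 𝔞] [LieAlgebra ℂ 𝔞]
    [AddCommGroup V] [Module ℂ V] [LieRingModule 𝔞 V] [LieModule ℂ 𝔞 V] : Prop :=
  ∀ v : V, ∃ W : LieSubmodule ℂ 𝔞 V, v ∈ W ∧ FiniteDimensional ℂ W

/-- A module over a Lie algebra is locally nilpotent if for every vector `v` there is `n ≥ 1` such
that `a₁ a₂ ⋯ aₙ v = 0` for all `a₁, …, aₙ` in the Lie algebra. -/
def IsLocallyNilpotentModule (𝔞 : Type*) (V : Type*) [LieRing 𝔞]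
    [AddCommGroup V] [LieRingModule 𝔞 V] : Prop :=
  ∀ v : V, ∃ n : ℕ, 0 < n ∧
    ∀ as : List 𝔞, as.length = n → as.foldr (fun a w => ⁅a, w⁆) v = 0

/-- A single element `x` of a Lie algebra acts locally nilpotently on a module. -/
def ActsLocallyNilpotently {𝔞 : Type*} (x : 𝔞) (V : Type*) [LieRing 𝔞]
    [AddCommGroup V] [LieRingModule 𝔞 V] : Prop :=
  ∀ v : V, ∃ n : ℕ, (fun w : V => ⁅x, w⁆)^[n] v = 0

namespace Virasoro

/-! ### Highest weight modules -/

/-- A highest weight module: generated by a nonzero vector that is annihilated by all `l i` with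
`i > 0` and on which `l 0` and `c` act by scalars. -/
def IsHighestWeightModule (L : Type*) [AddCommGroup L] [Module ℂ L] [LieRingModule Virasoro L]
    [LieModule ℂ Virasoro L] : Prop :=
  ∃ (h z : ℂ) (v : L), v ≠ 0 ∧ (∀ i : ℤ, 0 < i → ⁅l i, v⁆ = 0) ∧ ⁅l 0, v⁆ = h • v ∧
    ⁅c, v⁆ = z • v ∧ LieSubmodule.lieSpan ℂ Virasoro {v} = ⊤

/-! ### Induced modules -/

/-- The universal enveloping algebra `U(𝔙)`. -/
abbrev U : Type := UniversalEnvelopingAlgebra ℂ Virasoro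

/-- The universal enveloping algebra `U(𝔙₊)`. -/
abbrev UPlus : Type := UniversalEnvelopingAlgebra ℂ plus

/-- The canonical homomorphism `U(𝔙₊) → U(𝔙)`. -/
noncomputable def UPlus.toU : UPlus →ₐ[ℂ] U :=
  UniversalEnvelopingAlgebra.lift ℂ ((UniversalEnvelopingAlgebra.ι ℂ).comp plus.incl)

section Induced

variable (N : Type u) [AddCommGroup N] [Module ℂ N] [LieRingModule plus N] [LieModule ℂ plus N]

/-- The action of `U(𝔙₊)` on a `𝔙₊`-module. -/
noncomputable def UPlus.act : UPlus →ₐ[ℂ] Module.End ℂ N :=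
  UniversalEnvelopingAlgebra.lift ℂ (LieModule.toEnd ℂ plus N)

/-- The relations `u a ⊗ x = u ⊗ a x` (`u ∈ U(𝔙)`, `a ∈ U(𝔙₊)`, `x ∈ N`) that turn `U(𝔙) ⊗_ℂ N`
into `U(𝔙) ⊗_{U(𝔙₊)} N`. -/
noncomputable def indRel : Submodule U (U ⊗[ℂ] N) :=
  Submodule.span U {t | ∃ (w : U) (a : UPlus) (x : N),
    t = (w * UPlus.toU a) ⊗ₜ[ℂ] x - w ⊗ₜ[ℂ] (UPlus.act N a x)}

/-- The induced module `Ind(N) = U(𝔙) ⊗_{U(𝔙₊)} N`, as a left `U(𝔙)`-module. -/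
abbrev Ind : Type u := (U ⊗[ℂ] N) ⧸ indRel N

/-- The submodule `(c - θ) Ind(N)` of `Ind(N)`. -/
noncomputable def centralRel (θ : ℂ) : Submodule U (Ind N) :=
  Submodule.span U (Set.range fun t : Ind N =>
    (UniversalEnvelopingAlgebra.ι ℂ c - algebraMap ℂ U θ) • t)

/-- The module `Ind_θ(N) = Ind(N) / (c - θ) Ind(N)`. -/
def IndTheta (θ : ℂ) : Type u := Ind N ⧸ centralRel N θ

variable (θ : ℂ)

noncomputable instance : AddCommGroup (IndTheta N θ) :=
  inferInstanceAs (AddCommGroup (Ind N ⧸ centralRel N θ))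

noncomputable instance : Module U (IndTheta N θ) :=
  inferInstanceAs (Module U (Ind N ⧸ centralRel N θ))

noncomputable instance : Module ℂ (IndTheta N θ) :=
  inferInstanceAs (Module ℂ (Ind N ⧸ centralRel N θ))

instance : IsScalarTower ℂ U (IndTheta N θ) :=
  inferInstanceAs (IsScalarTower ℂ U (Ind N ⧸ centralRel N θ))

/-- The Virasoro algebra acts on `Ind_θ(N)` through `U(𝔙)`. -/
noncomputable instance : LieRingModule Virasoro (IndTheta N θ) where
  bracket x m := (UniversalEnvelopingAlgebra.ι ℂ x : U) • m
  add_lie x y m := by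
    change (UniversalEnvelopingAlgebra.ι ℂ (x + y) : U) • m = _
    rw [map_add, add_smul]
  lie_add x m n := smul_add _ m n
  leibniz_lie x y m := by
    change (UniversalEnvelopingAlgebra.ι ℂ x : U) • (UniversalEnvelopingAlgebra.ι ℂ y : U) • m =
      (UniversalEnvelopingAlgebra.ι ℂ ⁅x, y⁆ : U) • m +
      (UniversalEnvelopingAlgebra.ι ℂ y : U) • (UniversalEnvelopingAlgebra.ι ℂ x : U) • m
    rw [LieHom.map_lie, LieRing.of_associative_ring_bracket, sub_smul, mul_smul, mul_smul,
      sub_add_cancel]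

theorem IndTheta.lie_def (x : Virasoro) (m : IndTheta N θ) :
    ⁅x, m⁆ = (UniversalEnvelopingAlgebra.ι ℂ x : U) • m := rfl

noncomputable instance : LieModule ℂ Virasoro (IndTheta N θ) where
  smul_lie a x m := by
    rw [IndTheta.lie_def, IndTheta.lie_def, map_smul, smul_assoc]
  lie_smul a x m := by
    rw [IndTheta.lie_def, IndTheta.lie_def, ← algebraMap_smul U a m,
      ← algebraMap_smul U a ((UniversalEnvelopingAlgebra.ι ℂ x : U) • m), smul_smul, smul_smul,
      Algebra.commutes]

/-- The quotient map `Ind(N) → Ind_θ(N)`. -/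
noncomputable def IndTheta.mk : Ind N →ₗ[U] IndTheta N θ := (centralRel N θ).mkQ

variable {N}

/-- The element `1 ⊗ x` of `Ind_θ(N)`. -/
noncomputable def IndTheta.oneTmul (x : N) : IndTheta N θ :=
  IndTheta.mk N θ ((indRel N).mkQ ((1 : U) ⊗ₜ[ℂ] x))

end Induced

/-- The hypotheses on a `𝔙₊`-module `N` and `k`: `N` is simple, `l k` acts injectively on `N`, and
`l i` acts by zero on `N` for all `i > k`. -/
def IsInducingModule (k : ℕ) (N : Type*) [AddCommGroup N] [Module ℂ N] [LieRingModule plus N]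
    [LieModule ℂ plus N] : Prop :=
  LieModule.IsIrreducible ℂ plus N ∧
  Function.Injective (fun x : N => ⁅lPlus k, x⁆) ∧
  ∀ i : ℕ, k < i → ∀ x : N, ⁅lPlus i, x⁆ = 0

/-! ### Vectors annihilated by all `l i` with `i > k` -/

/-- The `𝔙₊`-submodule `{v ∈ L : l i v = 0 for all i > k}` of a `𝔙`-module `L`. -/
noncomputable def annihilatedAbove (L : Type*) [AddCommGroup L] [Module ℂ L]
    [LieRingModule Virasoro L] [LieModule ℂ Virasoro L] (k : ℕ) : LieSubmodule ℂ plus L where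
  carrier := {v | ∀ i : ℤ, (k : ℤ) < i → ⁅l i, v⁆ = 0}
  zero_mem' i _ := lie_zero _
  add_mem' hv hw i hi := by rw [lie_add, hv i hi, hw i hi, add_zero]
  smul_mem' a v hv i hi := by rw [lie_smul, hv i hi, smul_zero]
  lie_mem := by
    rintro ⟨x, hx⟩ v hv i hi
    change x ∈ Submodule.span ℂ (l '' {i : ℤ | 0 ≤ i}) at hx
    change ⁅l i, ⁅x, v⁆⁆ = 0
    induction hx using Submodule.span_induction with
    | zero => rw [zero_lie, lie_zero]
    | add x y _ _ hx hy => rw [add_lie, lie_add, hx, hy, add_zero]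
    | smul a x _ hx => rw [smul_lie, lie_smul, hx, smul_zero]
    | mem x hx =>
      obtain ⟨j, hj, rfl⟩ := hx
      have hj' : 0 ≤ j := hj
      have h0 : ¬ i = -j := by lia
      have hvi : ⁅l i, v⁆ = 0 := hv i hi
      have hvij : ⁅l (i + j), v⁆ = 0 := hv (i + j) (by lia)
      rw [leibniz_lie, lie_l_l, if_neg h0, zero_smul, add_zero, smul_lie, hvij, hvi, smul_zero,
        lie_zero, add_zero]

end Virasoro

set_option linter.unusedSectionVars false

namespace Virasoro

/-! ### Action of the basis elements; stable subspaces -/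

section Basic

variable {M : Type*} [AddCommGroup M] [Module ℂ M] [LieRingModule Virasoro M]
  [LieModule ℂ Virasoro M]

/-! Conditions (a) and (b) both amount to the existence of a nonzero `v` in the simple module `L`
killed by all `l i` with `i > n`, for some `n ≥ 1`. Given such a `v`, the vectors killed by all long
enough products of such `l i` form a submodule, hence all of `L` (`exists_mem_killed`); the same
holds for the vectors killed by all high enough `l i` (`exists_annihilatedAbove_bound`). The first
fact gives local nilpotency; together they give local finiteness, since only finitely many `l i`
matter at each step. Conversely, a last nonzero product yields `v` from (b), and a shortest linear
relation among the operators `l i` on a finite-dimensional stable subspace yields `v` from (a).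

For (c), let `k` be the least level above which all `l i` act locally nilpotently, and let `N` be
the space killed by all `l i`, `i > k`. It is nonzero, and `c` is a scalar by Schur's lemma in
countable dimension.

If `k > 0`, minimality makes `l k` injective on `N`. Filter the words in the `l z`, `z < 0`, applied
to `N` by degree (the sum of the indices), then by length; the order of the letters affects only
lower terms. On leading terms `l (p + k)` acts as `-(2p + k)` times the derivative in the variable
`l (-p)`, combined with `l k` on `N`. Induction on the length shows that monomials with coefficients
in `N` are independent in `L` (`eq_zero_of_sum_eq_zero`). The same monomials span `Ind_θ(N)`, so the
canonical map is injective, and it is onto because `L` is simple. Comparing coefficients of the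
empty monomial shows that `N` is simple. Only the spanning half of the Poincaré–Birkhoff–Witt
theorem is needed in `Ind_θ(N)`.

If `k = 0`, an eigenvector of `l 0` in `N` is required. Without one, `v` in `N` is free over the
polynomials in `l 0`, and a similar leading-term argument makes the monomials in the `l z`, `z ≤ 0`,
independent on `v`. But `l 0 v` generates `L`, so `v` is a combination of monomials each containing
an extra `l 0`, which independence forbids. -/

theorem lie_c_right (x : Virasoro) : ⁅x, c⁆ = 0 := bracketₗ_c_right x

theorem lie_lie_c (x : Virasoro) (w : M) : ⁅x, ⁅c, w⁆⁆ = ⁅c, ⁅x, w⁆⁆ := by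
  rw [leibniz_lie, lie_c_right, zero_lie, zero_add]

/-- The coefficient of `c` in `⁅l i, l j⁆`. -/
noncomputable def centralCoeff (i j : ℤ) : ℂ :=
  if i = -j then ((i : ℂ) ^ 3 - (i : ℂ)) / 12 else 0

theorem centralCoeff_of_ne {i j : ℤ} (h : i + j ≠ 0) : centralCoeff i j = 0 :=
  if_neg fun h' => h (by lia)

theorem l_lie_l (i j : ℤ) (w : M) :
    ⁅l i, ⁅l j, w⁆⁆ =
      ⁅l j, ⁅l i, w⁆⁆ + ((j : ℂ) - i) • ⁅l (i + j), w⁆ + centralCoeff i j • ⁅c, w⁆ := by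
  rw [leibniz_lie, lie_l_l, add_lie, smul_lie, smul_lie, centralCoeff]
  abel

theorem l_lie_l_of_ne {i j : ℤ} (h : i + j ≠ 0) (w : M) :
    ⁅l i, ⁅l j, w⁆⁆ = ⁅l j, ⁅l i, w⁆⁆ + ((j : ℂ) - i) • ⁅l (i + j), w⁆ := by
  rw [l_lie_l, centralCoeff_of_ne h, zero_smul, add_zero]

/-- The central term of `⁅l 2, l (-2)⁆` is `c / 2`, so stability under the `l i` alone makes a
subspace a submodule. -/
theorem c_lie_eq (w : M) :
    ⁅c, w⁆ = (2 : ℂ) • (⁅l 2, ⁅l (-2), w⁆⁆ - ⁅l (-2), ⁅l 2, w⁆⁆ + (4 : ℂ) • ⁅l 0, w⁆) := by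
  rw [l_lie_l 2 (-2), centralCoeff, if_pos (by norm_num)]
  norm_num
  module

theorem l_mem_lie_stable {W : Submodule ℂ M} (hl : ∀ i : ℤ, ∀ w ∈ W, ⁅l i, w⁆ ∈ W)
    (x : Virasoro) {w : M} (hw : w ∈ W) : ⁅x, w⁆ ∈ W := by
  induction x using induction_basis with
  | hl i => exact hl i w hw
  | hc =>
    rw [c_lie_eq]
    exact W.smul_mem _ (W.add_mem (W.sub_mem (hl _ _ (hl _ _ hw)) (hl _ _ (hl _ _ hw)))
      (W.smul_mem _ (hl _ _ hw)))
  | h0 => rw [zero_lie]; exact W.zero_mem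
  | hadd x y hx hy => rw [add_lie]; exact W.add_mem hx hy
  | hsmul a x hx => rw [smul_lie]; exact W.smul_mem _ hx

/-- A subspace stable under all `l i` is a submodule over the Virasoro algebra. -/
def submoduleOfStable (W : Submodule ℂ M) (hl : ∀ i : ℤ, ∀ w ∈ W, ⁅l i, w⁆ ∈ W) :
    LieSubmodule ℂ Virasoro M where
  toSubmodule := W
  lie_mem {x _} hw := l_mem_lie_stable hl x hw

theorem eq_top_of_stable (hM : LieModule.IsIrreducible ℂ Virasoro M) (W : Submodule ℂ M)
    (hl : ∀ i : ℤ, ∀ w ∈ W, ⁅l i, w⁆ ∈ W) {w : M} (hw : w ∈ W) (h0 : w ≠ 0) : W = ⊤ := by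
  rcases hM.eq_bot_or_eq_top (submoduleOfStable W hl) with h | h
  · have : w ∈ submoduleOfStable W hl := hw
    rw [h] at this
    exact absurd this h0
  · have := congrArg LieSubmodule.toSubmodule h
    exact this

theorem exists_ne_zero_of_isIrreducible (hM : LieModule.IsIrreducible ℂ Virasoro M) :
    ∃ v : M, v ≠ 0 := by
  by_contra! h
  obtain ⟨A, B, hAB⟩ := hM.exists_pair_ne
  exact hAB (LieSubmodule.ext _ _ fun m => by simp [h m])

theorem mem_annihilatedAbove {k : ℕ} {v : M} :
    v ∈ annihilatedAbove M k ↔ ∀ i : ℤ, (k : ℤ) < i → ⁅l i, v⁆ = 0 := Iff.rfl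

theorem mem_plus_of_nonneg {i : ℤ} (hi : 0 ≤ i) : l i ∈ plus :=
  Submodule.subset_span ⟨i, hi, rfl⟩

theorem l_lie_mem_annihilatedAbove {k : ℕ} {v : M} (hv : v ∈ annihilatedAbove M k) {i : ℤ}
    (hi : 0 ≤ i) : ⁅l i, v⁆ ∈ annihilatedAbove M k :=
  (annihilatedAbove M k).lie_mem (x := (⟨l i, mem_plus_of_nonneg hi⟩ : plus)) hv

theorem annihilatedAbove_mono {k k' : ℕ} (h : k ≤ k') {v : M} (hv : v ∈ annihilatedAbove M k) :
    v ∈ annihilatedAbove M k' := fun i hi => hv i (by lia)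

theorem plusAbove_toSubmodule (n : ℕ) :
    (plusAbove n).toSubmodule = Submodule.span ℂ (l '' {i : ℤ | (n : ℤ) < i}) := by
  refine le_antisymm ?_ LieSubalgebra.submodule_span_le_lieSpan
  intro x hx
  change x ∈ LieSubalgebra.lieSpan ℂ Virasoro (l '' {i : ℤ | (n : ℤ) < i}) at hx
  induction hx using LieSubalgebra.lieSpan_induction with
  | mem x hx => exact Submodule.subset_span hx
  | zero => exact Submodule.zero_mem _
  | smul a x _ hx => exact Submodule.smul_mem _ _ hx
  | add x y _ _ hx hy => exact Submodule.add_mem _ hx hy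
  | lie x y hx' hy' hx hy =>
    clear hx' hy'
    induction hx using Submodule.span_induction with
    | zero => rw [zero_lie]; exact Submodule.zero_mem _
    | add x x' _ _ hx hx' => rw [add_lie]; exact Submodule.add_mem _ hx hx'
    | smul a x _ hx => rw [smul_lie]; exact Submodule.smul_mem _ _ hx
    | mem x hx =>
      obtain ⟨i, hi, rfl⟩ := hx
      induction hy using Submodule.span_induction with
      | zero => rw [lie_zero]; exact Submodule.zero_mem _
      | add y y' _ _ hy hy' => rw [lie_add]; exact Submodule.add_mem _ hy hy'
      | smul a y _ hy => rw [lie_smul]; exact Submodule.smul_mem _ _ hy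
      | mem y hy =>
        obtain ⟨j, hj, rfl⟩ := hy
        have hi' : (n : ℤ) < i := hi
        have hj' : (n : ℤ) < j := hj
        rw [lie_l_l, if_neg (by lia), zero_smul, add_zero]
        exact Submodule.smul_mem _ _
          (Submodule.subset_span ⟨i + j, by change (n : ℤ) < i + j; lia, rfl⟩)

theorem l_mem_plusAbove {n : ℕ} {i : ℤ} (hi : (n : ℤ) < i) : l i ∈ plusAbove n :=
  LieSubalgebra.subset_lieSpan ⟨i, hi, rfl⟩

theorem plusAbove_induction {n : ℕ} {p : Virasoro → Prop} (hl : ∀ i : ℤ, (n : ℤ) < i → p (l i))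
    (h0 : p 0) (hadd : ∀ x y, p x → p y → p (x + y)) (hsmul : ∀ (a : ℂ) x, p x → p (a • x))
    {x : Virasoro} (hx : x ∈ plusAbove n) : p x := by
  have hx' : x ∈ Submodule.span ℂ (l '' {i : ℤ | (n : ℤ) < i}) := by
    rw [← plusAbove_toSubmodule]; exact hx
  clear hx
  induction hx' using Submodule.span_induction with
  | mem x h => obtain ⟨i, hi, rfl⟩ := h; exact hl i hi
  | zero => exact h0
  | add x y _ _ h h' => exact hadd x y h h'
  | smul a x _ h => exact hsmul a x h

end Basic

/-! ### From one annihilated vector to local nilpotency and local finiteness -/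

section Nilpotent

variable (M : Type*) [AddCommGroup M] [Module ℂ M] [LieRingModule Virasoro M]
  [LieModule ℂ Virasoro M]

/-- The subspace of vectors killed by all products of `s` elements `l i` with `i > m`. -/
def killed (m : ℕ) : ℕ → Submodule ℂ M
  | 0 => ⊥
  | s + 1 =>
    { carrier := {w | ∀ i : ℤ, (m : ℤ) < i → ⁅l i, w⁆ ∈ killed m s}
      zero_mem' := fun i _ => by rw [lie_zero]; exact Submodule.zero_mem _
      add_mem' := fun hv hw i hi => by
        rw [lie_add]; exact Submodule.add_mem _ (hv i hi) (hw i hi)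
      smul_mem' := fun a v hv i hi => by
        rw [lie_smul]; exact Submodule.smul_mem _ _ (hv i hi) }

variable {M} {m : ℕ}

theorem mem_killed_zero {w : M} : w ∈ killed M m 0 ↔ w = 0 := Iff.rfl

theorem killed_mono_succ (s : ℕ) : killed M m s ≤ killed M m (s + 1) := by
  induction s with
  | zero =>
    intro w hw
    rw [mem_killed_zero] at hw
    subst hw
    exact Submodule.zero_mem _
  | succ s ih => exact fun w hw i hi => ih (hw i hi)

theorem killed_mono : Monotone (killed M m) := monotone_nat_of_le_succ killed_mono_succ

theorem c_lie_mem_killed {s : ℕ} {w : M} (hw : w ∈ killed M m s) : ⁅c, w⁆ ∈ killed M m s := by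
  induction s generalizing w with
  | zero => rw [mem_killed_zero] at hw ⊢; rw [hw, lie_zero]
  | succ s ih => intro i hi; rw [lie_lie_c]; exact ih (hw i hi)

/-- Double induction on `d` and `s`. Commuting `l i`, `i > m`, past `l j` leaves `l j` on an earlier
step of the filtration, the operator `l (i + j)` with smaller defect `d` because `i ≥ 1`, and a
central term that preserves the step. -/
theorem exists_l_lie_mem_killed (d s : ℕ) :
    ∃ t : ℕ, ∀ j : ℤ, (m : ℤ) < j + d → ∀ w ∈ killed M m s, ⁅l j, w⁆ ∈ killed M m t := by
  induction d generalizing s with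
  | zero =>
    exact ⟨s, fun j hj w hw => killed_mono_succ s hw j (by simpa using hj)⟩
  | succ d ihd =>
    induction s with
    | zero =>
      refine ⟨0, fun j _ w hw => ?_⟩
      rw [mem_killed_zero] at hw ⊢
      rw [hw, lie_zero]
    | succ s ihs =>
      obtain ⟨t₁, h₁⟩ := ihs
      obtain ⟨t₂, h₂⟩ := ihd (s + 1)
      refine ⟨max (max t₁ t₂) (s + 1) + 1, fun j hj w hw i hi => ?_⟩
      rw [l_lie_l]
      refine Submodule.add_mem _ (Submodule.add_mem _ ?_ (Submodule.smul_mem _ _ ?_))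
        (Submodule.smul_mem _ _ ?_)
      · exact killed_mono (by lia) (h₁ j hj _ (hw i hi))
      · exact killed_mono (by lia) (h₂ (i + j) (by push_cast at hj; lia) _ hw)
      · exact killed_mono (by lia) (c_lie_mem_killed hw)

/-- By `exists_l_lie_mem_killed`, each `l i` carries a step of the filtration into some later step,
so its union is a submodule; it contains `v`. -/
theorem exists_mem_killed (hM : LieModule.IsIrreducible ℂ Virasoro M) {v : M}
    (hv : v ∈ annihilatedAbove M m) (h0 : v ≠ 0) (w : M) : ∃ s, w ∈ killed M m s := by
  let W : Submodule ℂ M :=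
    { carrier := {w | ∃ s, w ∈ killed M m s}
      zero_mem' := ⟨0, Submodule.zero_mem _⟩
      add_mem' := by
        rintro a b ⟨s, hs⟩ ⟨t, ht⟩
        exact ⟨max s t, Submodule.add_mem _ (killed_mono (le_max_left s t) hs)
          (killed_mono (le_max_right s t) ht)⟩
      smul_mem' := by
        rintro a b ⟨s, hs⟩
        exact ⟨s, Submodule.smul_mem _ _ hs⟩ }
  have hW : W = ⊤ := by
    refine eq_top_of_stable hM W ?_ (w := v) ⟨1, fun i hi => mem_killed_zero.2 (hv i hi)⟩ h0
    rintro i w ⟨s, hs⟩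
    obtain ⟨t, ht⟩ := exists_l_lie_mem_killed (M := M) (m := m) (m + 1 - i).toNat s
    exact ⟨t, ht i (by lia) w hs⟩
  have : w ∈ W := by rw [hW]; trivial
  exact this

theorem plusAbove_lie_mem_killed {s : ℕ} {w : M} (hw : w ∈ killed M m (s + 1)) {x : Virasoro}
    (hx : x ∈ plusAbove m) : ⁅x, w⁆ ∈ killed M m s := by
  refine plusAbove_induction (p := fun x => ⁅x, w⁆ ∈ killed M m s) (fun i hi => hw i hi) ?_ ?_ ?_ hx
  · rw [zero_lie]; exact Submodule.zero_mem _
  · intro x y hx hy; rw [add_lie]; exact Submodule.add_mem _ hx hy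
  · intro a x hx; rw [smul_lie]; exact Submodule.smul_mem _ _ hx

theorem isLocallyNilpotentModule_of_mem (hM : LieModule.IsIrreducible ℂ Virasoro M) {v : M}
    (hv : v ∈ annihilatedAbove M m) (h0 : v ≠ 0) : IsLocallyNilpotentModule (plusAbove m) M := by
  intro w
  obtain ⟨s, hs⟩ := exists_mem_killed hM hv h0 w
  refine ⟨s + 1, s.succ_pos, fun as has => ?_⟩
  have key : ∀ (as : List (plusAbove m)) (s : ℕ), w ∈ killed M m (s + as.length) →
      as.foldr (fun a w => ⁅a, w⁆) w ∈ killed M m s := by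
    intro as
    induction as with
    | nil => intro s h; exact h
    | cons a as ih =>
      intro s h
      exact plusAbove_lie_mem_killed (ih (s + 1) (by rw [List.length_cons] at h; convert h using 2; lia)) a.2
  have := key as 0 (killed_mono (by lia) hs)
  exact mem_killed_zero.1 this

theorem actsLocallyNilpotently_of_mem (hM : LieModule.IsIrreducible ℂ Virasoro M) {v : M}
    (hv : v ∈ annihilatedAbove M m) (h0 : v ≠ 0) {i : ℤ} (hi : (m : ℤ) < i) :
    ActsLocallyNilpotently (l i) M := by
  intro w
  obtain ⟨s, hs⟩ := exists_mem_killed hM hv h0 w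
  refine ⟨s, ?_⟩
  induction s generalizing w with
  | zero => exact mem_killed_zero.1 hs
  | succ s ih => rw [Function.iterate_succ_apply]; exact ih _ (hs i hi)

theorem exists_annihilatedAbove_bound (hM : LieModule.IsIrreducible ℂ Virasoro M) {v : M}
    (hv : v ∈ annihilatedAbove M m) (h0 : v ≠ 0) (w : M) : ∃ r, w ∈ annihilatedAbove M r := by
  let W : Submodule ℂ M :=
    { carrier := {w | ∃ r, w ∈ annihilatedAbove M r}
      zero_mem' := ⟨0, zero_mem _⟩
      add_mem' := by
        rintro a b ⟨s, hs⟩ ⟨t, ht⟩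
        exact ⟨max s t, add_mem (annihilatedAbove_mono (le_max_left s t) hs)
          (annihilatedAbove_mono (le_max_right s t) ht)⟩
      smul_mem' := by
        rintro a b ⟨s, hs⟩
        exact ⟨s, (annihilatedAbove M s).smul_mem _ hs⟩ }
  have hW : W = ⊤ := by
    refine eq_top_of_stable hM W ?_ (w := v) ⟨m, hv⟩ h0
    rintro j w ⟨r, hr⟩
    -- For `i > r + |j|` both `i` and `i + j` exceed `r ≥ 0`, so both commutator terms vanish and no
    -- central term occurs.
    refine ⟨r + j.natAbs, fun i hi => ?_⟩
    have hj := neg_abs_le j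
    have hj' := le_abs_self j
    have hj'' := abs_nonneg j
    push_cast at hi
    rw [l_lie_l_of_ne (by lia), hr i (by lia), hr (i + j) (by lia), smul_zero, lie_zero, add_zero]
  have : w ∈ W := by rw [hW]; trivial
  exact this

/-- Only `l i` with `m < i ≤ r` can move `w`. Each such image is one step earlier in the filtration
and still killed above `r`, so the line of `w` plus finitely many inductively built spaces suffices.
-/
theorem exists_finite_stable {r s : ℕ} {w : M} (hw : w ∈ killed M m s)
    (hr : w ∈ annihilatedAbove M r) :
    ∃ W : Submodule ℂ M, w ∈ W ∧ FiniteDimensional ℂ W ∧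
      ∀ i : ℤ, (m : ℤ) < i → ∀ u ∈ W, ⁅l i, u⁆ ∈ W := by
  induction s generalizing w with
  | zero =>
    rw [mem_killed_zero] at hw
    subst hw
    refine ⟨⊥, Submodule.zero_mem _, inferInstance, fun i _ u hu => ?_⟩
    rw [Submodule.mem_bot] at hu
    rw [hu, lie_zero]
    exact Submodule.zero_mem _
  | succ s ih =>
    have h : ∀ i : Finset.Ioc (m : ℤ) r, ∃ W : Submodule ℂ M, ⁅l i, w⁆ ∈ W ∧
        FiniteDimensional ℂ W ∧ ∀ i : ℤ, (m : ℤ) < i → ∀ u ∈ W, ⁅l i, u⁆ ∈ W := by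
      rintro ⟨i, hi⟩
      rw [Finset.mem_Ioc] at hi
      exact ih (hw i hi.1) (l_lie_mem_annihilatedAbove hr (by lia))
    choose W hwW hfd hst using h
    have hsup : ∀ i : ℤ, (m : ℤ) < i → ∀ u ∈ ⨆ j, W j, ⁅l i, u⁆ ∈ ⨆ j, W j := by
      intro i hi u hu
      induction hu using Submodule.iSup_induction' with
      | mem j u hu => exact Submodule.mem_iSup_of_mem j (hst j i hi u hu)
      | zero => rw [lie_zero]; exact Submodule.zero_mem _
      | add u v _ _ hu hv => rw [lie_add]; exact Submodule.add_mem _ hu hv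
    refine ⟨Submodule.span ℂ {w} ⊔ ⨆ j, W j,
      Submodule.mem_sup_left (Submodule.mem_span_singleton_self w), inferInstance, ?_⟩
    intro i hi u hu
    obtain ⟨y, hy, z, hz, rfl⟩ := Submodule.mem_sup.1 hu
    obtain ⟨a, rfl⟩ := Submodule.mem_span_singleton.1 hy
    rw [lie_add, lie_smul]
    refine Submodule.mem_sup_right (Submodule.add_mem _ (Submodule.smul_mem _ _ ?_) (hsup i hi z hz))
    by_cases hir : i ≤ r
    · exact Submodule.mem_iSup_of_mem ⟨i, Finset.mem_Ioc.2 ⟨hi, hir⟩⟩ (hwW _)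
    · rw [hr i (by lia)]
      exact Submodule.zero_mem _

theorem isLocallyFiniteModule_of_mem (hM : LieModule.IsIrreducible ℂ Virasoro M) {v : M}
    (hv : v ∈ annihilatedAbove M m) (h0 : v ≠ 0) : IsLocallyFiniteModule (plusAbove m) M := by
  intro w
  obtain ⟨s, hs⟩ := exists_mem_killed hM hv h0 w
  obtain ⟨r, hr⟩ := exists_annihilatedAbove_bound hM hv h0 w
  obtain ⟨W, hw, hfd, hst⟩ := exists_finite_stable hs hr
  refine ⟨{ toSubmodule := W, lie_mem := ?_ }, hw, hfd⟩
  rintro ⟨x, hx⟩ u hu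
  change ⁅x, u⁆ ∈ W
  replace hu : u ∈ W := hu
  refine plusAbove_induction (p := fun x => ⁅x, u⁆ ∈ W) (fun i hi => hst i hi u hu) ?_ ?_ ?_ hx
  · rw [zero_lie]; exact Submodule.zero_mem _
  · intro x y hx hy; rw [add_lie]; exact Submodule.add_mem _ hx hy
  · intro a x hx; rw [smul_lie]; exact Submodule.smul_mem _ _ hx

theorem exists_mem_annihilatedAbove_of_isLocallyNilpotentModule {v : M} (h0 : v ≠ 0)
    (h : IsLocallyNilpotentModule (plusAbove m) M) : ∃ w ∈ annihilatedAbove M m, w ≠ 0 := by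
  obtain ⟨n, -, hn⟩ := h v
  induction n generalizing v with
  | zero => exact absurd (hn [] rfl) h0
  | succ n ih =>
    by_cases hv : v ∈ annihilatedAbove M m
    · exact ⟨v, hv, h0⟩
    · rw [mem_annihilatedAbove] at hv
      push Not at hv
      obtain ⟨i, hi, hne⟩ := hv
      refine ih hne fun as has => ?_
      have := hn (as ++ [⟨l i, l_mem_plusAbove hi⟩]) (by simp [has])
      rwa [List.foldr_append] at this

/-- The level is lowered one unit at a time: `l (n + 1)` preserves the space killed above `n + 1`,
and the last nonzero iterate on `v` is killed by it too. -/
theorem exists_mem_annihilatedAbove_of_actsLocallyNilpotently {k n : ℕ} {v : M}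
    (hv : v ∈ annihilatedAbove M n) (h0 : v ≠ 0)
    (hk : ∀ i : ℤ, (k : ℤ) < i → ActsLocallyNilpotently (l i) M) :
    ∃ w ∈ annihilatedAbove M k, w ≠ 0 := by
  induction n generalizing v with
  | zero => exact ⟨v, annihilatedAbove_mono k.zero_le hv, h0⟩
  | succ n ih =>
    by_cases hkn : n + 1 ≤ k
    · exact ⟨v, annihilatedAbove_mono hkn hv, h0⟩
    obtain ⟨t, ht⟩ := hk (n + 1) (by lia) v
    induction t generalizing v with
    | zero => exact absurd ht h0
    | succ t iht =>
      by_cases h : ⁅l ((n : ℤ) + 1), v⁆ = 0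
      · refine ih (v := v) (fun i hi => ?_) h0
        rcases (show i = n + 1 ∨ ((n + 1 : ℕ) : ℤ) < i by lia) with rfl | h'
        · exact h
        · exact hv i h'
      · exact iht (l_lie_mem_annihilatedAbove hv (by lia)) h
          (by rwa [Function.iterate_succ_apply] at ht)

end Nilpotent

/-! ### From local finiteness to an annihilated vector -/

section Finite

variable {M : Type*} [AddCommGroup M] [Module ℂ M] [LieRingModule Virasoro M]
  [LieModule ℂ Virasoro M]

/-- The infinitely many operators `l i` on `W` are linearly dependent. In a relation of least
support with at least two terms, the commutator with some `l i` from the support would be a shorter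
nonzero relation. -/
theorem exists_l_lie_eq_zero {k : ℕ} (W : Submodule ℂ M) [FiniteDimensional ℂ W]
    (hW : ∀ i : ℤ, (k : ℤ) < i → ∀ u ∈ W, ⁅l i, u⁆ ∈ W) :
    ∃ i : ℤ, (k : ℤ) < i ∧ ∀ u ∈ W, ⁅l i, u⁆ = 0 := by
  let p : (ℤ →₀ ℂ) → Prop := fun f => f ≠ 0 ∧ (∀ i ∈ f.support, (k : ℤ) < i) ∧
    ∀ u ∈ W, f.sum (fun i a => a • ⁅l i, u⁆) = 0
  have hex : ∃ n, ∃ f, p f ∧ f.support.card = n := by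
    let X : ℕ → Module.End ℂ W := fun n =>
      (LieModule.toEnd ℂ Virasoro M (l (n + k + 1))).restrict (p := W) (q := W)
        fun u hu => hW _ (by lia) u hu
    have hX : ¬ LinearIndependent ℂ X := fun h => by
      have := h.finite
      exact Infinite.not_finite this
    rw [linearIndependent_iff] at hX
    push Not at hX
    obtain ⟨g, hg, hg0⟩ := hX
    let e : ℕ ↪ ℤ := ⟨fun n => n + k + 1, fun a b h => by simpa using h⟩
    refine ⟨_, g.embDomain e, ⟨?_, ?_, ?_⟩, rfl⟩
    · simpa using hg0
    · intro i hi
      rw [Finsupp.support_embDomain, Finset.mem_map] at hi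
      obtain ⟨n, -, rfl⟩ := hi
      change (k : ℤ) < n + k + 1
      lia
    · intro u hu
      have := congrArg (fun T : Module.End ℂ W => ((T ⟨u, hu⟩ : W) : M)) hg
      rw [Finsupp.sum_embDomain]
      simp only [Finsupp.linearCombination_apply, Finsupp.sum, LinearMap.sum_apply,
        LinearMap.smul_apply, AddSubmonoidClass.coe_finsetSum, Submodule.coe_smul] at this
      exact this
  classical
  obtain ⟨f, ⟨hf0, hfk, hf⟩, hcard⟩ := Nat.find_spec hex
  obtain ⟨i, hi⟩ := Finsupp.support_nonempty_iff.2 hf0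
  have hki := hfk i hi
  by_cases hsingle : f.support = {i}
  · refine ⟨i, hki, fun u hu => ?_⟩
    have := hf u hu
    rw [Finsupp.sum, hsingle, Finset.sum_singleton] at this
    exact (smul_eq_zero.1 this).resolve_left (Finsupp.mem_support_iff.1 hi)
  · exfalso
    let e : ℤ ↪ ℤ := ⟨fun j => i + j, fun a b h => by simpa using h⟩
    -- The coefficients of `⁅l i, ∑ f j l j⁆`, with the index shift by `i` supplied separately by
    -- `e`; the factor `j - i` removes exactly the term `j = i`.
    let f' : ℤ →₀ ℂ := Finsupp.onFinset f.support (fun j => f j * ((j : ℂ) - i)) (by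
      intro j hj; rw [Finsupp.mem_support_iff]; exact left_ne_zero_of_mul hj)
    have hsupp : f'.support = f.support.erase i := by
      ext j
      simp only [f', Finsupp.mem_support_iff, Finsupp.onFinset_apply, Finset.mem_erase, ne_eq,
        mul_eq_zero, not_or, sub_eq_zero, Int.cast_inj]
      exact and_comm
    refine Nat.find_min hex (m := (f'.embDomain e).support.card) ?_ ⟨_, ⟨?_, ?_, ?_⟩, rfl⟩
    · rw [Finsupp.support_embDomain, Finset.card_map, hsupp, ← hcard]
      exact Finset.card_erase_lt_of_mem hi
    · rw [Ne, Finsupp.embDomain_eq_zero, ← Finsupp.support_eq_empty, hsupp]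
      intro h
      rw [Finset.erase_eq_empty_iff] at h
      rcases h with h | h
      · rw [h] at hi; exact absurd hi (Finset.notMem_empty _)
      · exact hsingle h
    · intro j hj
      rw [Finsupp.support_embDomain, Finset.mem_map, hsupp] at hj
      obtain ⟨n, hn, rfl⟩ := hj
      have := hfk n (Finset.mem_of_mem_erase hn)
      change (k : ℤ) < i + n
      lia
    · intro u hu
      have h1 := hf _ (hW i hki u hu)
      have h2 := congrArg (fun w => ⁅l i, w⁆) (hf u hu)
      simp only [Finsupp.sum, lie_zero, lie_sum, lie_smul] at h1 h2
      rw [Finsupp.sum_embDomain, Finsupp.sum_of_support_subset (s := f.support)]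
      · rw [← sub_eq_zero.2 (h2.trans h1.symm), ← Finset.sum_sub_distrib]
        refine Finset.sum_congr rfl fun j hj => ?_
        have := hfk j hj
        rw [l_lie_l_of_ne (by lia)]
        simp only [f', e, Finsupp.onFinset_apply]
        module
      · rw [hsupp]; exact Finset.erase_subset _ _
      · simp

theorem exists_mem_annihilatedAbove_of_isLocallyFiniteModule {k : ℕ} (v : M)
    (h : IsLocallyFiniteModule (plusAbove k) M) : ∃ n, 0 < n ∧ v ∈ annihilatedAbove M n := by
  obtain ⟨W, hv, hfd⟩ := h v
  have hW : ∀ i : ℤ, (k : ℤ) < i → ∀ u ∈ W.toSubmodule, ⁅l i, u⁆ ∈ W.toSubmodule :=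
    fun i hi u hu => W.lie_mem (x := (⟨l i, l_mem_plusAbove hi⟩ : plusAbove k)) hu
  have hfd' : FiniteDimensional ℂ W.toSubmodule := hfd
  obtain ⟨i, hki, hi⟩ := exists_l_lie_eq_zero W.toSubmodule hW
  have step : ∀ i : ℤ, (k : ℤ) < i → (∀ u ∈ W.toSubmodule, ⁅l i, u⁆ = 0) → ∀ j : ℤ, (k : ℤ) < j →
      j ≠ i → ∀ u ∈ W.toSubmodule, ⁅l (i + j), u⁆ = 0 := by
    intro i hki hi j hj hji u hu
    have := l_lie_l_of_ne (i := i) (j := j) (by lia) u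
    rw [hi u hu, hi _ (hW j hj u hu), lie_zero, zero_add] at this
    refine (smul_eq_zero.1 this.symm).resolve_left ?_
    exact sub_ne_zero.2 (by exact_mod_cast hji)
  have h1 : ∀ j : ℤ, i + k < j → j ≠ 2 * i → ∀ u ∈ W.toSubmodule, ⁅l j, u⁆ = 0 := by
    intro j hj hne u hu
    have := step i hki hi (j - i) (by lia) (by lia) u hu
    rwa [show i + (j - i) = j by ring] at this
  -- Since `k < i`, any bound from `2 * i` on passes both `i + k` and the exceptional index `2 * i`.
  refine ⟨(4 * i).toNat, by lia, fun j hj => h1 j (by lia) (by lia) v hv⟩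

end Finite

end Virasoro

/-! ### Schur's lemma in countable dimension -/

section Schur

open Polynomial

variable {V : Type*} [AddCommGroup V] [Module ℂ V]

/-- Over `ℂ`, `p(T)` is a nonzero scalar times a product of factors `T - a`, each injective on `W`.
The stable subspace `W` allows the later use with `T = l 0` on the space killed above `0`. -/
theorem Module.End.eq_zero_of_aeval_eq_zero {T : Module.End ℂ V} {W : Submodule ℂ V}
    (hW : ∀ v ∈ W, T v ∈ W) (hT : ∀ (a : ℂ), ∀ v ∈ W, T v = a • v → v = 0) {p : ℂ[X]}
    (hp : p ≠ 0) {v : V} (hv : v ∈ W) (h : aeval T p v = 0) : v = 0 := by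
  have hs := (IsAlgClosed.splits p).eq_prod_roots
  have key : ∀ (s : Multiset ℂ), ∀ w ∈ W,
      aeval T (s.map fun a => X - C a).prod w = 0 → w = 0 := by
    intro s
    induction s using Multiset.induction_on with
    | empty => intro w _ hw; simpa using hw
    | cons a s ih =>
      intro w hwW hw
      have hTa : aeval T (X - C a) w = T w - a • w := by
        rw [map_sub, aeval_X, aeval_C, LinearMap.sub_apply, Module.algebraMap_end_apply]
      rw [Multiset.map_cons, Multiset.prod_cons, mul_comm, map_mul, Module.End.mul_apply, hTa] at hw
      exact hT a w hwW (sub_eq_zero.1 (ih _ (W.sub_mem (hW w hwW) (W.smul_mem a hwW)) hw))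
  rw [hs, map_mul, aeval_C, Module.End.mul_apply, Module.algebraMap_end_apply] at h
  exact key _ v hv ((smul_eq_zero.1 h).resolve_left (leadingCoeff_ne_zero.2 hp))

/-- The `f a` play the role of `(T - a)⁻¹ v`. Clearing denominators in a relation gives a polynomial
in `T` killing `v`, hence the zero polynomial; evaluating it at `i` isolates the coefficient `g i`.
-/
theorem Module.End.linearIndependent_of_forall_sub_smul_eq {T : Module.End ℂ V}
    (hT : ∀ (a : ℂ) (v : V), T v = a • v → v = 0) {v : V} (hv : v ≠ 0) {f : ℂ → V}
    (hf : ∀ a, T (f a) - a • f a = v) : LinearIndependent ℂ f := by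
  classical
  rw [linearIndependent_iff']
  intro s g hg i hi
  let q : ℂ → ℂ[X] := fun j => ∏ a ∈ s.erase j, (X - C a)
  have h1 : ∀ j ∈ s, aeval T (∏ a ∈ s, (X - C a)) (f j) = aeval T (q j) v := by
    intro j hj
    rw [← Finset.prod_erase_mul _ _ hj, map_mul, Module.End.mul_apply]
    congr 1
    rw [map_sub, aeval_X, aeval_C, LinearMap.sub_apply, Module.algebraMap_end_apply, hf]
  have h2 : aeval T (∑ j ∈ s, C (g j) * q j) v = 0 := by
    have := congrArg (aeval T (∏ a ∈ s, (X - C a))) hg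
    rw [map_zero, map_sum] at this
    rw [map_sum, LinearMap.sum_apply, ← this]
    refine Finset.sum_congr rfl fun j hj => ?_
    rw [map_smul, h1 j hj, map_mul, aeval_C, Module.End.mul_apply, Module.algebraMap_end_apply]
  have h3 : ∑ j ∈ s, C (g j) * q j = 0 := by
    by_contra h
    exact hv (Module.End.eq_zero_of_aeval_eq_zero (W := ⊤) (fun _ _ => trivial)
      (fun a v _ => hT a v) h trivial h2)
  have h4 := congrArg (Polynomial.eval i) h3
  rw [Polynomial.eval_zero, Polynomial.eval_finsetSum, Finset.sum_eq_single i] at h4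
  · rw [eval_mul, eval_C] at h4
    refine (mul_eq_zero.1 h4).resolve_right ?_
    rw [eval_prod]
    refine Finset.prod_ne_zero_iff.2 fun a ha => ?_
    rw [eval_sub, eval_X, eval_C]
    exact sub_ne_zero.2 (Finset.ne_of_mem_erase ha).symm
  · intro j hj hji
    rw [eval_mul, eval_prod, Finset.prod_eq_zero (Finset.mem_erase.2 ⟨hji.symm, hi⟩) (by simp),
      mul_zero]
  · exact fun h => absurd hi h

/-- Otherwise the vectors `(T - a)⁻¹ v`, `a ∈ ℂ`, would be continuum many independent vectors in a
space of countable dimension. -/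
theorem Module.End.exists_eigenvector_or_not_surjective {ι : Type} [Countable ι] (w : ι → V)
    (hw : Submodule.span ℂ (Set.range w) = ⊤) {v : V} (hv : v ≠ 0) (T : Module.End ℂ V) :
    ∃ a : ℂ, (∃ u : V, u ≠ 0 ∧ T u = a • u) ∨
      LinearMap.range (T - algebraMap ℂ (Module.End ℂ V) a) ≠ ⊤ := by
  by_contra! h
  have hT : ∀ (a : ℂ) (v : V), T v = a • v → v = 0 := by
    intro a u hu
    by_contra h0
    exact (h a).1 u h0 hu
  have hf : ∀ a : ℂ, ∃ u, T u - a • u = v := by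
    intro a
    have : v ∈ LinearMap.range (T - algebraMap ℂ (Module.End ℂ V) a) := by rw [(h a).2]; trivial
    exact this
  choose f hf using hf
  have hli := (Module.End.linearIndependent_of_forall_sub_smul_eq hT hv hf).cardinal_lift_le_rank
  have hr : Module.rank ℂ V ≤ Cardinal.aleph0 := by
    rw [← rank_top, ← hw]
    exact (rank_span_le _).trans (Cardinal.mk_le_aleph0_iff.2 (Set.countable_range w).to_subtype)
  have h2 := hli.trans (Cardinal.lift_le.2 hr)
  rw [Cardinal.mk_complex, Cardinal.lift_continuum, Cardinal.lift_aleph0] at h2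
  exact absurd h2 (not_le.2 Cardinal.aleph0_lt_continuum)

end Schur

/-! ### Words in the generators and the central character -/

namespace Virasoro

variable {M : Type*} [AddCommGroup M] [Module ℂ M] [LieRingModule Virasoro M]
  [LieModule ℂ Virasoro M]

/-- The action of the product `l z₁ ⋯ l zᵣ`. -/
noncomputable def word (zs : List ℤ) : M →ₗ[ℂ] M :=
  (zs.map fun z => LieModule.toEnd ℂ Virasoro M (l z)).prod

@[simp] theorem word_nil (v : M) : word [] v = v := rfl

@[simp] theorem word_cons (z : ℤ) (zs : List ℤ) (v : M) :
    word (z :: zs) v = ⁅l z, word zs v⁆ := by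
  simp [word]

theorem word_append (xs zs : List ℤ) (v : M) : word (xs ++ zs) v = word xs (word zs v) := by
  simp [word]

theorem span_range_word (hM : LieModule.IsIrreducible ℂ Virasoro M) {v : M} (h0 : v ≠ 0) :
    Submodule.span ℂ (Set.range fun zs : List ℤ => word zs v) = ⊤ := by
  refine eq_top_of_stable hM _ (fun i w hw => ?_) (Submodule.subset_span ⟨[], rfl⟩) h0
  induction hw using Submodule.span_induction with
  | mem w hw =>
    obtain ⟨zs, rfl⟩ := hw
    exact Submodule.subset_span ⟨i :: zs, word_cons i zs v⟩
  | zero => rw [lie_zero]; exact Submodule.zero_mem _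
  | add x y _ _ hx hy => rw [lie_add]; exact Submodule.add_mem _ hx hy
  | smul a x _ hx => rw [lie_smul]; exact Submodule.smul_mem _ _ hx

/-- The kernel and the range of `c - θ` are submodules, so for the `θ` of the previous dichotomy
either the kernel is everything or the range is zero. -/
theorem exists_central_character (hM : LieModule.IsIrreducible ℂ Virasoro M) :
    ∃ θ : ℂ, ∀ v : M, ⁅c, v⁆ = θ • v := by
  obtain ⟨v, h0⟩ := exists_ne_zero_of_isIrreducible hM
  obtain ⟨θ, h⟩ := Module.End.exists_eigenvector_or_not_surjective _ (span_range_word hM h0) h0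
    (LieModule.toEnd ℂ Virasoro M c)
  have hcomm : ∀ (i : ℤ) (w : M), ⁅l i, ⁅c, w⁆ - θ • w⁆ = ⁅c, ⁅l i, w⁆⁆ - θ • ⁅l i, w⁆ := by
    intro i w
    rw [lie_sub, lie_smul, lie_lie_c]
  refine ⟨θ, fun w => ?_⟩
  rcases h with ⟨u, hu, hcu⟩ | h
  · have hk : LinearMap.ker (LieModule.toEnd ℂ Virasoro M c - algebraMap ℂ _ θ) = ⊤ := by
      refine eq_top_of_stable hM _ (fun i w hw => ?_) (w := u) (sub_eq_zero.2 hcu) hu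
      have hw' : ⁅c, w⁆ - θ • w = 0 := hw
      change ⁅c, ⁅l i, w⁆⁆ - θ • ⁅l i, w⁆ = 0
      rw [← hcomm, hw', lie_zero]
    have hw : w ∈ LinearMap.ker (LieModule.toEnd ℂ Virasoro M c - algebraMap ℂ _ θ) := by
      rw [hk]; trivial
    exact sub_eq_zero.1 hw
  · by_contra hne
    refine h (eq_top_of_stable hM _ ?_ (w := ⁅c, w⁆ - θ • w) ⟨w, rfl⟩ (sub_ne_zero.2 hne))
    rintro i _ ⟨w, rfl⟩
    exact ⟨⁅l i, w⁆, (hcomm i w).symm⟩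

end Virasoro

namespace Virasoro

/-! ### Filtration of words by degree and length -/

section Words

variable {M : Type*} [AddCommGroup M] [Module ℂ M] [LieRingModule Virasoro M]
  [LieModule ℂ Virasoro M]

/-- The span of the vectors `l z₁ ⋯ l zᵣ n` with `n ∈ N₀`, all `zᵢ ≤ b` and `P (∑ zᵢ) r`. -/
def wordSpan (b : ℤ) (N₀ : Submodule ℂ M) (P : ℤ → ℤ → Prop) : Submodule ℂ M :=
  Submodule.span ℂ {w | ∃ (zs : List ℤ) (n : M), (∀ z ∈ zs, z ≤ b) ∧ n ∈ N₀ ∧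
    P zs.sum zs.length ∧ word zs n = w}

/-- The span of the words of degree greater than `σ`, or of degree `σ` and length less than
`m`. -/
def lower (b : ℤ) (N₀ : Submodule ℂ M) (σ m : ℤ) : Submodule ℂ M :=
  wordSpan b N₀ fun t r => σ < t ∨ t = σ ∧ r < m

/-- The span of the words of degree at least `σ`. -/
def upper (b : ℤ) (N₀ : Submodule ℂ M) (σ : ℤ) : Submodule ℂ M :=
  wordSpan b N₀ fun t _ => σ ≤ t

variable {b : ℤ} {N₀ : Submodule ℂ M}

theorem word_mem_wordSpan {P : ℤ → ℤ → Prop} {zs : List ℤ} {n : M} (hz : ∀ z ∈ zs, z ≤ b)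
    (hn : n ∈ N₀) (h : P zs.sum zs.length) : word zs n ∈ wordSpan b N₀ P :=
  Submodule.subset_span ⟨zs, n, hz, hn, h, rfl⟩

theorem lie_mem_of_mem_wordSpan {P : ℤ → ℤ → Prop} {W : Submodule ℂ M} {x : Virasoro}
    (h : ∀ (zs : List ℤ) (n : M), (∀ z ∈ zs, z ≤ b) → n ∈ N₀ → P zs.sum zs.length →
      ⁅x, word zs n⁆ ∈ W) {w : M} (hw : w ∈ wordSpan b N₀ P) : ⁅x, w⁆ ∈ W := by
  have : wordSpan b N₀ P ≤ W.comap (LieModule.toEnd ℂ Virasoro M x) := by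
    refine Submodule.span_le.2 ?_
    rintro _ ⟨zs, n, hz, hn, hP, rfl⟩
    exact h zs n hz hn hP
  exact this hw

theorem wordSpan_mono {P Q : ℤ → ℤ → Prop} (h : ∀ t r, P t r → Q t r) :
    wordSpan b N₀ P ≤ wordSpan b N₀ Q := by
  refine Submodule.span_mono ?_
  rintro _ ⟨zs, n, hz, hn, hP, rfl⟩
  exact ⟨zs, n, hz, hn, h _ _ hP, rfl⟩

theorem lower_mono {σ m σ' m' : ℤ} (h : σ' < σ ∨ σ' = σ ∧ m ≤ m') :
    lower b N₀ σ m ≤ lower b N₀ σ' m' := wordSpan_mono fun t r => by lia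

theorem upper_le_lower {σ σ' m : ℤ} (h : σ' < σ) : upper b N₀ σ ≤ lower b N₀ σ' m :=
  wordSpan_mono fun t r => by lia

theorem upper_mono {σ σ' : ℤ} (h : σ' ≤ σ) : upper b N₀ σ ≤ upper b N₀ σ' :=
  wordSpan_mono fun t r => by lia

theorem list_sum_nonpos {zs : List ℤ} (h : ∀ z ∈ zs, z ≤ 0) : zs.sum ≤ 0 := by
  induction zs with
  | nil => simp
  | cons z zs ih =>
    rw [List.sum_cons]
    exact add_nonpos (h z List.mem_cons_self) (ih fun y hy => h y (List.mem_cons_of_mem _ hy))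

theorem lower_zero (hb : b ≤ 0) : lower b N₀ 0 0 = ⊥ := by
  rw [eq_bot_iff]
  refine Submodule.span_le.2 ?_
  rintro _ ⟨zs, n, hz, -, h, rfl⟩
  have : zs.sum ≤ 0 := list_sum_nonpos fun z hz' => (hz z hz').trans hb
  lia

theorem l_lie_mem_lower {z σ m : ℤ} (hz : z ≤ b) {w : M} (hw : w ∈ lower b N₀ σ m) :
    ⁅l z, w⁆ ∈ lower b N₀ (z + σ) (m + 1) := by
  refine lie_mem_of_mem_wordSpan (fun zs n hzs hn h => ?_) hw
  rw [← word_cons]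
  refine word_mem_wordSpan (by simpa using ⟨hz, hzs⟩) hn ?_
  simp only [List.sum_cons, List.length_cons]
  push_cast
  lia

theorem l_lie_mem_upper {z σ : ℤ} (hz : z ≤ b) {w : M} (hw : w ∈ upper b N₀ σ) :
    ⁅l z, w⁆ ∈ upper b N₀ (z + σ) := by
  refine lie_mem_of_mem_wordSpan (fun zs n hzs hn h => ?_) hw
  rw [← word_cons]
  refine word_mem_wordSpan (by simpa using ⟨hz, hzs⟩) hn ?_
  simp only [List.sum_cons]
  lia

theorem centralCoeff_of_nonpos {x y : ℤ} (hx : x ≤ 0) (hy : y ≤ 0) : centralCoeff x y = 0 := by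
  by_cases h : x + y = 0
  · have h1 : x = 0 := by lia
    subst h1
    simp [centralCoeff]
  · exact centralCoeff_of_ne h

/-- Swapping neighbours `l y`, `l x` costs a multiple of `l (x + y)`: same degree, one letter fewer,
and no central term for nonpositive indices. Hence `Multiset.toList` may be used with its arbitrary
order. -/
theorem word_sub_word_mem_lower (hb : b ≤ 0) {zs zs' : List ℤ} (h : zs.Perm zs')
    (hz : ∀ z ∈ zs, z ≤ b) {n : M} (hn : n ∈ N₀) :
    word zs n - word zs' n ∈ lower b N₀ zs.sum zs.length := by
  induction h with
  | nil => rw [sub_self]; exact Submodule.zero_mem _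
  | cons x h ih =>
    rw [word_cons, word_cons, ← lie_sub, List.sum_cons, List.length_cons]
    push_cast
    exact l_lie_mem_lower (hz x List.mem_cons_self) (ih fun z hz' => hz z (List.mem_cons_of_mem _ hz'))
  | swap x y zs =>
    have hx : x ≤ b := hz x (by simp)
    have hy : y ≤ b := hz y (by simp)
    rw [word_cons, word_cons, word_cons, word_cons, l_lie_l,
      centralCoeff_of_nonpos (hy.trans hb) (hx.trans hb), zero_smul, add_zero, add_sub_cancel_left,
      ← word_cons]
    refine Submodule.smul_mem _ _ (word_mem_wordSpan ?_ hn ?_)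
    · intro z hz'
      rcases List.mem_cons.1 hz' with rfl | hz'
      · lia
      · exact hz z (by simp [hz'])
    · right
      simp only [List.sum_cons, List.length_cons]
      push_cast
      lia
  | trans h h' ih ih' =>
    have h2 := ih' fun z hz' => hz z (h.mem_iff.2 hz')
    rw [← h.sum_eq, ← h.length_eq] at h2
    rw [← sub_add_sub_cancel]
    exact Submodule.add_mem _ (ih hz) h2

theorem l_lie_word_mem {θ : ℂ} (hc : ∀ v : M, ⁅c, v⁆ = θ • v)
    (hN : ∀ i : ℤ, b < i → ∀ n ∈ N₀, ⁅l i, n⁆ ∈ N₀) {zs : List ℤ} (hz : ∀ z ∈ zs, z ≤ b) (r : ℤ)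
    {n : M} (hn : n ∈ N₀) : ⁅l r, word zs n⁆ ∈ wordSpan b N₀ fun _ _ => True := by
  induction zs generalizing r with
  | nil =>
    by_cases hr : r ≤ b
    · exact word_mem_wordSpan (zs := [r]) (n := n) (by simpa using hr) hn trivial
    · exact word_mem_wordSpan (zs := []) (by simp) (hN r (by lia) n hn) trivial
  | cons z zs ih =>
    have hzs : ∀ z ∈ zs, z ≤ b := fun z hz' => hz z (List.mem_cons_of_mem _ hz')
    rw [word_cons, l_lie_l, hc]
    refine Submodule.add_mem _ (Submodule.add_mem _ ?_ (Submodule.smul_mem _ _ (ih hzs _)))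
      (Submodule.smul_mem _ _ (Submodule.smul_mem _ _ (word_mem_wordSpan hzs hn trivial)))
    refine lie_mem_of_mem_wordSpan (fun ys n hys hn _ => ?_) (ih hzs r)
    rw [← word_cons]
    exact word_mem_wordSpan (by simpa using ⟨hz z List.mem_cons_self, hys⟩) hn trivial

theorem l_lie_mem_wordSpan_true {θ : ℂ} (hc : ∀ v : M, ⁅c, v⁆ = θ • v)
    (hN : ∀ i : ℤ, b < i → ∀ n ∈ N₀, ⁅l i, n⁆ ∈ N₀) (r : ℤ) (w : M)
    (hw : w ∈ wordSpan b N₀ fun _ _ => True) : ⁅l r, w⁆ ∈ wordSpan b N₀ fun _ _ => True :=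
  lie_mem_of_mem_wordSpan (fun _ _ hz hn _ => l_lie_word_mem hc hN hz r hn) hw

section Eval

variable {N : Type*} [AddCommGroup N] [Module ℂ N]

/-- The value of a formal combination of multisets of indices with coefficients in `N`. -/
noncomputable def evalMon (j : N →ₗ[ℂ] M) : (Multiset ℤ →₀ N) →ₗ[ℂ] M :=
  Finsupp.lsum ℂ fun s => word s.toList ∘ₗ j

theorem evalMon_apply (j : N →ₗ[ℂ] M) (F : Multiset ℤ →₀ N) :
    evalMon j F = ∑ s ∈ F.support, word s.toList (j (F s)) := rfl

theorem evalMon_single (j : N →ₗ[ℂ] M) (s : Multiset ℤ) (n : N) :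
    evalMon j (Finsupp.single s n) = word s.toList (j n) := by
  simp [evalMon]

/-- The spanning half of Poincaré–Birkhoff–Witt. Sorting a word leaves words of higher degree, or of
equal degree and smaller length; as degrees are at most `0`, induction on minus the degree and then
on the length terminates. -/
theorem exists_evalMon_eq (hb : b ≤ 0) (j : N →ₗ[ℂ] M) {w : M}
    (hw : w ∈ wordSpan b (LinearMap.range j) fun _ _ => True) :
    ∃ F : Multiset ℤ →₀ N, (∀ s ∈ F.support, ∀ z ∈ s, z ≤ b) ∧ evalMon j F = w := by
  let S := (Finsupp.supported N ℂ {s : Multiset ℤ | ∀ z ∈ s, z ≤ b}).map (evalMon j)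
  have key : ∀ (d m : ℕ) (zs : List ℤ), (∀ z ∈ zs, z ≤ b) → -zs.sum = d → zs.length = m →
      ∀ n, word zs (j n) ∈ S := by
    intro d
    induction d using Nat.strong_induction_on with
    | _ d ihd =>
      intro m
      induction m using Nat.strong_induction_on with
      | _ m ihm =>
        intro zs hz hd hm n
        have hperm : zs.Perm (zs : Multiset ℤ).toList :=
          Multiset.coe_eq_coe.1 (Multiset.coe_toList _).symm
        have h1 := word_sub_word_mem_lower hb hperm hz (N₀ := LinearMap.range j) ⟨n, rfl⟩
        have h2 : lower b (LinearMap.range j) zs.sum zs.length ≤ S := by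
          refine Submodule.span_le.2 ?_
          rintro _ ⟨ys, _, hy, ⟨n', rfl⟩, h, rfl⟩
          have : ys.sum ≤ 0 := list_sum_nonpos fun z hz' => (hy z hz').trans hb
          rcases h with h | ⟨h, h'⟩
          · exact ihd (-ys.sum).toNat (by lia) _ ys hy (by lia) rfl n'
          · exact ihm ys.length (by lia) ys hy (by lia) rfl n'
        have h3 : word (zs : Multiset ℤ).toList (j n) ∈ S := by
          refine ⟨Finsupp.single (zs : Multiset ℤ) n, ?_, evalMon_single _ _ _⟩
          exact Finsupp.single_mem_supported ℂ n (by simpa using hz)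
        simpa using S.add_mem (h2 h1) h3
  have hS : wordSpan b (LinearMap.range j) (fun _ _ => True) ≤ S := by
    refine Submodule.span_le.2 ?_
    rintro _ ⟨zs, _, hz, ⟨n, rfl⟩, -, rfl⟩
    have : zs.sum ≤ 0 := list_sum_nonpos fun z hz' => (hz z hz').trans hb
    exact key (-zs.sum).toNat zs.length zs hz (by lia) rfl n
  obtain ⟨F, hF, rfl⟩ := hS hw
  exact ⟨F, fun s hs => hF hs, rfl⟩

end Eval

/-- The sum over the occurrences of `q` in `zs` of the vectors in which the corresponding factor is
replaced by the word `pre`, moved to the right of the factors preceding it. -/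
noncomputable def replaceSum (q : ℤ) (pre : List ℤ) (x : M) : List ℤ → M
  | [] => 0
  | z :: zs => ⁅l z, replaceSum q pre x zs⁆ + if z = q then word (pre ++ zs) x else 0

theorem replaceSum_mem_lower {q : ℤ} {pre : List ℤ} {x : M} (hx : x ∈ N₀)
    (hpre : ∀ z ∈ pre, z ≤ b) {zs : List ℤ} (hz : ∀ z ∈ zs, z ≤ b) :
    replaceSum q pre x zs ∈ lower b N₀ (zs.sum - q + pre.sum) (zs.length + pre.length) := by
  induction zs with
  | nil => exact Submodule.zero_mem _
  | cons z zs ih =>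
    have hzs : ∀ z ∈ zs, z ≤ b := fun z hz' => hz z (List.mem_cons_of_mem _ hz')
    refine Submodule.add_mem _ ?_ ?_
    · refine lower_mono ?_ (l_lie_mem_lower (hz z List.mem_cons_self) (ih hzs))
      simp only [List.sum_cons, List.length_cons]
      push_cast
      lia
    · split_ifs with h
      · refine word_mem_wordSpan ?_ hx ?_
        · intro y hy
          rcases List.mem_append.1 hy with hy | hy
          · exact hpre y hy
          · exact hzs y hy
        · simp only [List.sum_cons, List.length_cons, List.sum_append, List.length_append]
          push_cast
          lia
      · exact Submodule.zero_mem _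

/-- Modulo reordering all occurrences of `q` contribute equally, so the sum behaves like a partial
derivative in the variable `l q`, multiplied by `pre`. -/
theorem replaceSum_sub_mem_lower (hb : b ≤ 0) {q : ℤ} (hq : q ≤ b) {pre : List ℤ} {x : M}
    (hx : x ∈ N₀) (hpre : ∀ z ∈ pre, z ≤ b) {zs : List ℤ} (hz : ∀ z ∈ zs, z ≤ b) :
    replaceSum q pre x zs - (zs.count q : ℂ) • word (pre ++ zs.erase q) x ∈
      lower b N₀ (zs.sum - q + pre.sum) (zs.length - 1 + pre.length) := by
  induction zs with
  | nil => simp [replaceSum]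
  | cons z zs ih =>
    have hzs : ∀ z ∈ zs, z ≤ b := fun z hz' => hz z (List.mem_cons_of_mem _ hz')
    have h1 := l_lie_mem_lower (hz z List.mem_cons_self) (ih hzs)
    rw [lie_sub, lie_smul, ← word_cons] at h1
    have e1 : (z :: zs).sum - q + pre.sum = z + (zs.sum - q + pre.sum) := by
      rw [List.sum_cons]; ring
    have e2 : (((z :: zs).length : ℕ) : ℤ) - 1 + pre.length = zs.length - 1 + pre.length + 1 := by
      rw [List.length_cons]; push_cast; ring
    rw [e1, e2, replaceSum]
    by_cases h : z = q
    · subst h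
      rw [if_pos rfl, List.erase_cons_head, List.count_cons_self]
      push_cast
      by_cases hmem : z ∈ zs
      · have hp : (z :: (pre ++ zs.erase z)).Perm (pre ++ zs) :=
          List.perm_middle.symm.trans ((List.perm_cons_erase hmem).symm.append_left pre)
        have hall : ∀ y ∈ z :: (pre ++ zs.erase z), y ≤ b := by
          intro y hy
          rcases List.mem_append.1 (hp.mem_iff.1 hy) with hy | hy
          · exact hpre y hy
          · exact hzs y hy
        have h2 := word_sub_word_mem_lower hb hp hall hx
        rw [hp.sum_eq, hp.length_eq] at h2
        have h3 := Submodule.add_mem _ h1 (Submodule.smul_mem _ (zs.count z : ℂ) (lower_mono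
          (σ' := z + (zs.sum - z + pre.sum)) (m' := zs.length - 1 + pre.length + 1) (by
            rw [List.sum_append, List.length_append]; push_cast; lia) h2))
        convert h3 using 1
        module
      · rw [List.count_eq_zero_of_not_mem hmem] at h1 ⊢
        convert h1 using 1
        push_cast
        module
    · rw [if_neg h, add_zero, List.erase_cons_tail (by simpa using h),
        List.count_cons_of_ne h]
      have hp : (z :: (pre ++ zs.erase q)).Perm (pre ++ z :: zs.erase q) := List.perm_middle.symm
      by_cases hmem : q ∈ zs
      · have hall : ∀ y ∈ z :: (pre ++ zs.erase q), y ≤ b := by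
          intro y hy
          rcases List.mem_append.1 (hp.mem_iff.1 hy) with hy | hy
          · exact hpre y hy
          · rcases List.mem_cons.1 hy with rfl | hy
            · exact hz _ List.mem_cons_self
            · exact hzs y (List.mem_of_mem_erase hy)
        have h2 := word_sub_word_mem_lower hb hp hall hx
        have hs : q + (zs.erase q).sum = zs.sum := by
          rw [← List.sum_cons]; exact (List.perm_cons_erase hmem).symm.sum_eq
        have hl : (zs.erase q).length + 1 = zs.length := by
          rw [← List.length_cons]; exact (List.perm_cons_erase hmem).symm.length_eq
        have h3 := Submodule.add_mem _ h1 (Submodule.smul_mem _ (zs.count q : ℂ) (lower_mono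
          (σ' := z + (zs.sum - q + pre.sum)) (m' := zs.length - 1 + pre.length + 1) (by
            rw [List.sum_cons, List.length_cons, List.sum_append, List.length_append]
            push_cast; lia) h2))
        convert h3 using 1
        module
      · rw [List.count_eq_zero_of_not_mem hmem] at h1 ⊢
        convert h1 using 1
        push_cast
        module

/-- The leading part has least degree and, within that degree, greatest length. -/
theorem exists_leading {A : Finset (Multiset ℤ)} (hA : A.Nonempty) :
    ∃ (σ : ℤ) (m : ℕ), (∃ s ∈ A, s.sum = σ ∧ s.card = m) ∧
      ∀ s ∈ A, σ < s.sum ∨ s.sum = σ ∧ s.card ≤ m := by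
  obtain ⟨s₀, hs₀, hmin⟩ := A.exists_min_image Multiset.sum hA
  obtain ⟨s₁, hs₁, hmax⟩ := (A.filter fun s => s.sum = s₀.sum).exists_max_image Multiset.card
    ⟨s₀, by simp [hs₀]⟩
  rw [Finset.mem_filter] at hs₁
  refine ⟨s₀.sum, s₁.card, ⟨s₁, hs₁.1, hs₁.2, rfl⟩, fun s hs => ?_⟩
  rcases (hmin s hs).lt_or_eq with h | h
  · exact Or.inl h
  · exact Or.inr ⟨h.symm, hmax s (Finset.mem_filter.2 ⟨hs, h.symm⟩)⟩

end Words

end Virasoro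

namespace Virasoro

/-! ### Independence of monomials when `k > 0` -/

section PositiveLevel

variable {M : Type*} [AddCommGroup M] [Module ℂ M] [LieRingModule Virasoro M]
  [LieModule ℂ Virasoro M] {N₀ : Submodule ℂ M} {θ : ℂ} {k : ℕ}

/-- A negative `l r` just joins the word. A nonnegative one may be absorbed by `N₀`, but only once
its index is at most `k`, so the degree rises by at least `r - k` and never falls. -/
theorem l_lie_word_mem_upper (hc : ∀ v : M, ⁅c, v⁆ = θ • v)
    (hN : ∀ i : ℤ, -1 < i → ∀ n ∈ N₀, ⁅l i, n⁆ ∈ N₀)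
    (hN0 : ∀ i : ℤ, (k : ℤ) < i → ∀ n ∈ N₀, ⁅l i, n⁆ = 0)
    {zs : List ℤ} (hz : ∀ z ∈ zs, z ≤ -1) {n : M} (hn : n ∈ N₀) (r : ℤ) :
    ⁅l r, word zs n⁆ ∈ upper (-1) N₀ (zs.sum + max (r - k) (min r 0)) := by
  induction zs generalizing r with
  | nil =>
    rw [word_nil]
    by_cases hr : r ≤ -1
    · rw [← word_nil n, ← word_cons]
      refine word_mem_wordSpan (by simpa using hr) hn ?_
      simp only [List.sum_cons, List.sum_nil]
      lia
    · by_cases hrk : (k : ℤ) < r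
      · rw [hN0 r hrk n hn]; exact Submodule.zero_mem _
      · refine word_mem_wordSpan (zs := []) (by simp) (hN r (by lia) n hn) ?_
        simp only [List.sum_nil]
        lia
  | cons z zs ih =>
    have hzs : ∀ z ∈ zs, z ≤ -1 := fun z hz' => hz z (List.mem_cons_of_mem _ hz')
    have hz1 : z ≤ -1 := hz z List.mem_cons_self
    rw [word_cons, l_lie_l, hc, List.sum_cons]
    refine Submodule.add_mem _ (Submodule.add_mem _ ?_ (Submodule.smul_mem _ _ ?_)) ?_
    · exact upper_mono (by lia) (l_lie_mem_upper hz1 (ih hzs r))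
    · exact upper_mono (by lia) (ih hzs (r + z))
    · by_cases h : r + z = 0
      · refine Submodule.smul_mem _ _ (Submodule.smul_mem _ _ (word_mem_wordSpan hzs hn ?_))
        lia
      · rw [centralCoeff_of_ne h, zero_smul]; exact Submodule.zero_mem _

theorem l_lie_word_sub_mem_lower (hk : 0 < k) (hc : ∀ v : M, ⁅c, v⁆ = θ • v)
    (hN : ∀ i : ℤ, -1 < i → ∀ n ∈ N₀, ⁅l i, n⁆ ∈ N₀)
    (hN0 : ∀ i : ℤ, (k : ℤ) < i → ∀ n ∈ N₀, ⁅l i, n⁆ = 0)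
    {zs : List ℤ} (hz : ∀ z ∈ zs, z ≤ -1) {n : M} (hn : n ∈ N₀) :
    ⁅l k, word zs n⁆ - word zs ⁅l k, n⁆ ∈ lower (-1) N₀ zs.sum zs.length := by
  induction zs with
  | nil => rw [word_nil, word_nil, sub_self]; exact Submodule.zero_mem _
  | cons z zs ih =>
    have hzs : ∀ z ∈ zs, z ≤ -1 := fun z hz' => hz z (List.mem_cons_of_mem _ hz')
    have hz1 : z ≤ -1 := hz z List.mem_cons_self
    have h1 := l_lie_mem_lower hz1 (ih hzs)
    rw [lie_sub] at h1
    rw [word_cons, word_cons, l_lie_l, hc, List.sum_cons, List.length_cons, add_assoc,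
      add_sub_right_comm]
    push_cast
    refine Submodule.add_mem _ h1 (Submodule.add_mem _ (Submodule.smul_mem _ _ ?_)
      (Submodule.smul_mem _ _ (Submodule.smul_mem _ _ ?_)))
    · exact upper_le_lower (by lia) (l_lie_word_mem_upper hc hN hN0 hzs hn (k + z))
    · exact word_mem_wordSpan hzs hn (by lia)

/-- The leading contribution comes from `⁅l (p + k), l (-p)⁆ = -(2p + k) l k`, after which `l k`
passes to `n` modulo lower terms. -/
theorem l_lie_word_add_mem_lower (hk : 0 < k) (hc : ∀ v : M, ⁅c, v⁆ = θ • v)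
    (hN : ∀ i : ℤ, -1 < i → ∀ n ∈ N₀, ⁅l i, n⁆ ∈ N₀)
    (hN0 : ∀ i : ℤ, (k : ℤ) < i → ∀ n ∈ N₀, ⁅l i, n⁆ = 0)
    {zs : List ℤ} (hz : ∀ z ∈ zs, z ≤ -1) {n : M} (hn : n ∈ N₀) {p : ℤ} (hp : 0 < p) :
    ⁅l (p + k), word zs n⁆ + (2 * p + k : ℂ) • replaceSum (-p) [] ⁅l k, n⁆ zs ∈
      lower (-1) N₀ (zs.sum + p) (zs.length - 1) := by
  induction zs generalizing p with
  | nil =>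
    rw [word_nil, hN0 _ (by lia) n hn, replaceSum, smul_zero, add_zero]
    exact Submodule.zero_mem _
  | cons z zs ih =>
    have hzs : ∀ z ∈ zs, z ≤ -1 := fun z hz' => hz z (List.mem_cons_of_mem _ hz')
    have hz1 : z ≤ -1 := hz z List.mem_cons_self
    have hkn := hN k (by lia) n hn
    have h1 := l_lie_mem_lower hz1 (ih hzs hp)
    rw [lie_add, lie_smul] at h1
    have e1 : (z :: zs).sum + p = z + (zs.sum + p) := by rw [List.sum_cons]; ring
    have e2 : (((z :: zs).length : ℕ) : ℤ) - 1 = zs.length - 1 + 1 := by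
      rw [List.length_cons]; push_cast; ring
    rw [e1, e2, word_cons, l_lie_l, hc, replaceSum]
    by_cases h : z = -p
    · subst h
      rw [centralCoeff_of_ne (by lia), zero_smul, add_zero, if_pos rfl, List.nil_append,
        show p + k + -p = (k : ℤ) by ring]
      have h2 := l_lie_word_sub_mem_lower hk hc hN hN0 hzs hn
      have h3 := Submodule.add_mem _ h1 (Submodule.smul_mem _ (-(2 * p + k : ℂ))
        (lower_mono (σ' := -p + (zs.sum + p)) (m' := zs.length - 1 + 1) (by lia) h2))
      convert h3 using 1
      push_cast
      module
    · rw [if_neg h, add_zero]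
      have key : ((z : ℂ) - ((p + k : ℤ) : ℂ)) • ⁅l (p + k + z), word zs n⁆ +
          centralCoeff (p + k) z • θ • word zs n ∈
          lower (-1) N₀ (z + (zs.sum + p)) (zs.length - 1 + 1) := by
        -- For `z < -p` the new index is below `k`, so the degree rises by more than `p`. For `z >
        -- -p` the new index still exceeds `k` and a second letter must be consumed, so the length
        -- drops further.
        rcases lt_or_gt_of_ne h with hlt | hgt
        · refine Submodule.add_mem _ (Submodule.smul_mem _ _ ?_)
            (Submodule.smul_mem _ _ (Submodule.smul_mem _ _ ?_))
          · exact upper_le_lower (by lia) (l_lie_word_mem_upper hc hN hN0 hzs hn (p + k + z))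
          · exact word_mem_wordSpan hzs hn (by lia)
        · rw [centralCoeff_of_ne (by lia), zero_smul, add_zero]
          refine Submodule.smul_mem _ _ ?_
          have h2 := ih hzs (p := p + z) (by lia)
          have h3 := replaceSum_mem_lower (q := -(p + z)) (pre := []) hkn (by simp) hzs
          have h4 := Submodule.sub_mem _
            (lower_mono (σ' := z + (zs.sum + p)) (m' := zs.length - 1 + 1) (by lia) h2)
            (Submodule.smul_mem _ (2 * ((p + z : ℤ) : ℂ) + k)
              (lower_mono (σ' := z + (zs.sum + p)) (m' := zs.length - 1 + 1)
                (by simp only [List.sum_nil, List.length_nil]; lia) h3))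
          rw [add_sub_cancel_right, show p + z + k = p + k + z by ring] at h4
          exact h4
      convert Submodule.add_mem _ h1 key using 1
      module

theorem l_lie_mem_lower_of_pos (hk : 0 < k) (hc : ∀ v : M, ⁅c, v⁆ = θ • v)
    (hN : ∀ i : ℤ, -1 < i → ∀ n ∈ N₀, ⁅l i, n⁆ ∈ N₀)
    (hN0 : ∀ i : ℤ, (k : ℤ) < i → ∀ n ∈ N₀, ⁅l i, n⁆ = 0) {p : ℤ} (hp : 0 < p) {σ m : ℤ} {w : M}
    (hw : w ∈ lower (-1) N₀ σ (m + 1)) : ⁅l (p + k), w⁆ ∈ lower (-1) N₀ (σ + p) m := by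
  refine lie_mem_of_mem_wordSpan (fun zs n hz hn h => ?_) hw
  rcases h with h | ⟨h, h'⟩
  · exact upper_le_lower (by lia) (l_lie_word_mem_upper hc hN hN0 hz hn (p + k))
  · have h2 := l_lie_word_add_mem_lower hk hc hN hN0 hz hn hp
    have h3 := replaceSum_mem_lower (q := -p) (pre := []) (hN k (by lia) n hn) (by simp) hz
    have h4 := Submodule.sub_mem _ (lower_mono (σ' := σ + p) (m' := m) (by lia) h2)
      (Submodule.smul_mem _ (2 * p + k : ℂ) (lower_mono (σ' := σ + p) (m' := m)
        (by simp only [List.sum_nil, List.length_nil]; lia) h3))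
    rwa [add_sub_cancel_right] at h4

theorem l_lie_monomial_add_mem_lower (hk : 0 < k) (hc : ∀ v : M, ⁅c, v⁆ = θ • v)
    (hN : ∀ i : ℤ, -1 < i → ∀ n ∈ N₀, ⁅l i, n⁆ ∈ N₀)
    (hN0 : ∀ i : ℤ, (k : ℤ) < i → ∀ n ∈ N₀, ⁅l i, n⁆ = 0)
    {s : Multiset ℤ} (hs : ∀ z ∈ s, z ≤ -1) {n : M} (hn : n ∈ N₀) {p : ℤ} (hp : 0 < p) :
    ⁅l (p + k), word s.toList n⁆ +
        ((2 * p + k : ℂ) * s.count (-p)) • word (s.erase (-p)).toList ⁅l k, n⁆ ∈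
      lower (-1) N₀ (s.sum + p) (s.card - 1) := by
  classical
  have hz : ∀ z ∈ s.toList, z ≤ -1 := fun z hz => hs z (Multiset.mem_toList.1 hz)
  have hkn := hN k (by lia) n hn
  have h1 := l_lie_word_add_mem_lower hk hc hN hN0 hz hn hp
  have h2 := replaceSum_sub_mem_lower (by norm_num) (q := -p) (by lia) (pre := []) hkn (by simp) hz
  have hcount : s.toList.count (-p) = s.count (-p) := by
    rw [← Multiset.coe_count, Multiset.coe_toList]
  rw [hcount, List.nil_append, List.sum_nil, List.length_nil] at h2
  rw [Multiset.sum_toList, Multiset.length_toList] at h1 h2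
  have h3 : (s.count (-p) : ℂ) • (word (s.toList.erase (-p)) ⁅l k, n⁆ -
      word (s.erase (-p)).toList ⁅l k, n⁆) ∈ lower (-1) N₀ (s.sum + p) (s.card - 1) := by
    by_cases hmem : -p ∈ s
    · have hperm : (s.toList.erase (-p)).Perm (s.erase (-p)).toList := by
        rw [← Multiset.coe_eq_coe, ← Multiset.coe_erase, Multiset.coe_toList, Multiset.coe_toList]
      have h := word_sub_word_mem_lower (by norm_num) hperm
        (fun z hz' => hz z (List.mem_of_mem_erase hz')) hkn
      rw [hperm.sum_eq, hperm.length_eq, Multiset.sum_toList, Multiset.length_toList] at h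
      have e1 : -p + (s.erase (-p)).sum = s.sum := by
        rw [← Multiset.sum_cons, Multiset.cons_erase hmem]
      have e2 := Multiset.card_erase_add_one hmem
      exact Submodule.smul_mem _ _ (lower_mono (by lia) h)
    · rw [Multiset.count_eq_zero_of_notMem hmem, Nat.cast_zero, zero_smul]
      exact Submodule.zero_mem _
  have h4 := Submodule.sub_mem _ h1 (Submodule.smul_mem _ (2 * p + k : ℂ)
    (Submodule.add_mem _ (lower_mono (σ' := s.sum + p) (m' := s.card - 1) (by lia) h2) h3))
  convert h4 using 1
  module

/-- Induction on the length: `l (p + k)` differentiates the leading part in `l (-p)` and applies `l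
k` to the coefficients. Since `2p + k`, the multiplicities and `l k` are all injective, nothing is
lost. -/
theorem eq_zero_of_sum_mem_lower (hk : 0 < k) (hc : ∀ v : M, ⁅c, v⁆ = θ • v)
    (hN : ∀ i : ℤ, -1 < i → ∀ n ∈ N₀, ⁅l i, n⁆ ∈ N₀)
    (hN0 : ∀ i : ℤ, (k : ℤ) < i → ∀ n ∈ N₀, ⁅l i, n⁆ = 0)
    (hinj : ∀ n ∈ N₀, ⁅l k, n⁆ = 0 → n = 0) {σ : ℤ} {m : ℕ} {A : Finset (Multiset ℤ)}
    (hA : ∀ s ∈ A, (∀ z ∈ s, z ≤ -1) ∧ s.sum = σ ∧ s.card = m) {f : Multiset ℤ → M}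
    (hf : ∀ s ∈ A, f s ∈ N₀)
    (hsum : ∑ s ∈ A, word s.toList (f s) ∈ lower (-1) N₀ σ m) : ∀ s ∈ A, f s = 0 := by
  classical
  induction m generalizing σ A f with
  | zero =>
    intro s hs
    have h0 : ∀ t ∈ A, t = 0 := fun t ht => Multiset.card_eq_zero.1 (hA t ht).2.2
    obtain rfl := h0 s hs
    have hσ : σ = 0 := (hA 0 hs).2.1.symm
    have hA' : A = {0} := Finset.eq_singleton_iff_unique_mem.2 ⟨hs, h0⟩
    rw [hσ, hA', Finset.sum_singleton, Nat.cast_zero, lower_zero (by norm_num), Submodule.mem_bot,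
      Multiset.toList_zero, word_nil] at hsum
    exact hsum
  | succ m ih =>
    intro s₀ hs₀
    obtain ⟨z, hzs⟩ : ∃ z, z ∈ s₀ := Multiset.card_pos_iff_exists_mem.1 (by rw [(hA s₀ hs₀).2.2]; lia)
    have hz1 := (hA s₀ hs₀).1 z hzs
    obtain ⟨p, rfl⟩ : ∃ p, z = -p := ⟨-z, by ring⟩
    have hp : 0 < p := by lia
    have hpk : (2 * p + k : ℂ) ≠ 0 := by
      have : (2 * p + k : ℤ) ≠ 0 := by lia
      exact_mod_cast this
    have h1 := l_lie_mem_lower_of_pos hk hc hN hN0 hp (m := m) (by exact_mod_cast hsum)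
    have h2 : ∑ s ∈ A, (s.count (-p) : ℂ) • word (s.erase (-p)).toList ⁅l k, f s⁆ ∈
        lower (-1) N₀ (σ + p) m := by
      have h3 : ∑ s ∈ A, (⁅l (p + k), word s.toList (f s)⁆ +
          ((2 * p + k : ℂ) * s.count (-p)) • word (s.erase (-p)).toList ⁅l k, f s⁆) ∈
          lower (-1) N₀ (σ + p) m := by
        refine Submodule.sum_mem _ fun s hs => ?_
        obtain ⟨ha, hb, hd⟩ := hA s hs
        have := l_lie_monomial_add_mem_lower hk hc hN hN0 ha (hf s hs) hp
        rw [hb, hd] at this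
        exact lower_mono (by push_cast; lia) this
      rw [Finset.sum_add_distrib, ← lie_sum] at h3
      have h4 := (Submodule.add_mem_iff_right _ h1).1 h3
      simp only [mul_smul] at h4
      rw [← Finset.smul_sum] at h4
      exact (Submodule.smul_mem_iff _ hpk).1 h4
    have hinjOn : Set.InjOn (fun s : Multiset ℤ => s.erase (-p))
        ((A.filter fun s => -p ∈ s : Finset (Multiset ℤ)) : Set (Multiset ℤ)) := by
      intro s hs t ht hst
      rw [Finset.mem_coe, Finset.mem_filter] at hs ht
      rw [← Multiset.cons_erase hs.2, ← Multiset.cons_erase ht.2]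
      exact congrArg _ hst
    -- The shortened monomials are indexed by `t = s.erase (-p)`, and `-p ::ₘ t` recovers `s`.
    have h5 := ih (σ := σ + p) (A := (A.filter fun s => -p ∈ s).image fun s => s.erase (-p))
      (f := fun t => ((-p ::ₘ t).count (-p) : ℂ) • ⁅l k, f (-p ::ₘ t)⁆) ?_ ?_ ?_
    · have h6 := h5 (s₀.erase (-p))
        (Finset.mem_image_of_mem _ (Finset.mem_filter.2 ⟨hs₀, hzs⟩))
      simp only [Multiset.cons_erase hzs] at h6
      refine hinj _ (hf s₀ hs₀) ((smul_eq_zero.1 h6).resolve_left ?_)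
      exact_mod_cast Multiset.count_ne_zero.2 hzs
    · intro t ht
      obtain ⟨s, hs, rfl⟩ := Finset.mem_image.1 ht
      rw [Finset.mem_filter] at hs
      obtain ⟨ha, hb, hd⟩ := hA s hs.1
      have e1 : -p + (s.erase (-p)).sum = s.sum := by
        rw [← Multiset.sum_cons, Multiset.cons_erase hs.2]
      have e2 := Multiset.card_erase_add_one hs.2
      exact ⟨fun z hz => ha z (Multiset.mem_of_mem_erase hz), by lia, by lia⟩
    · intro t ht
      obtain ⟨s, hs, rfl⟩ := Finset.mem_image.1 ht
      rw [Finset.mem_filter] at hs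
      simp only [Multiset.cons_erase hs.2]
      exact Submodule.smul_mem _ _ (hN k (by lia) _ (hf s hs.1))
    · rw [Finset.sum_image hinjOn, Finset.sum_filter]
      convert h2 using 1
      refine Finset.sum_congr rfl fun s hs => ?_
      split_ifs with hmem
      · rw [Multiset.cons_erase hmem, map_smul]
      · rw [Multiset.count_eq_zero_of_notMem hmem, Nat.cast_zero, zero_smul]

theorem eq_zero_of_sum_eq_zero (hk : 0 < k) (hc : ∀ v : M, ⁅c, v⁆ = θ • v)
    (hN : ∀ i : ℤ, -1 < i → ∀ n ∈ N₀, ⁅l i, n⁆ ∈ N₀)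
    (hN0 : ∀ i : ℤ, (k : ℤ) < i → ∀ n ∈ N₀, ⁅l i, n⁆ = 0)
    (hinj : ∀ n ∈ N₀, ⁅l k, n⁆ = 0 → n = 0) {A : Finset (Multiset ℤ)}
    (hA : ∀ s ∈ A, ∀ z ∈ s, z ≤ -1) {f : Multiset ℤ → M} (hf : ∀ s ∈ A, f s ∈ N₀)
    (hsum : ∑ s ∈ A, word s.toList (f s) = 0) : ∀ s ∈ A, f s = 0 := by
  classical
  by_contra! hne
  obtain ⟨t, ht, ht0⟩ := hne
  obtain ⟨σ, m, ⟨s₀, hs₀, hσ, hm⟩, hlead⟩ :=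
    exists_leading (A := A.filter fun s => f s ≠ 0) ⟨t, Finset.mem_filter.2 ⟨ht, ht0⟩⟩
  rw [Finset.mem_filter] at hs₀
  have h := eq_zero_of_sum_mem_lower hk hc hN hN0 hinj (σ := σ) (m := m) (f := f)
    (A := A.filter fun s => s.sum = σ ∧ s.card = m) ?_ ?_ ?_
  · exact hs₀.2 (h s₀ (Finset.mem_filter.2 ⟨hs₀.1, hσ, hm⟩))
  · intro s hs
    rw [Finset.mem_filter] at hs
    exact ⟨hA s hs.1, hs.2⟩
  · intro s hs
    rw [Finset.mem_filter] at hs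
    exact hf s hs.1
  · rw [← Finset.sum_filter_add_sum_filter_not A fun s => s.sum = σ ∧ s.card = m] at hsum
    rw [eq_neg_of_add_eq_zero_left hsum]
    refine Submodule.neg_mem _ (Submodule.sum_mem _ fun s hs => ?_)
    rw [Finset.mem_filter] at hs
    by_cases hs0 : f s = 0
    · rw [hs0, map_zero]; exact Submodule.zero_mem _
    · have h1 := hlead s (Finset.mem_filter.2 ⟨hs.1, hs0⟩)
      refine word_mem_wordSpan (fun z hz => hA s hs.1 z (Multiset.mem_toList.1 hz)) (hf s hs.1) ?_
      rw [Multiset.sum_toList, Multiset.length_toList]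
      lia

end PositiveLevel

end Virasoro

namespace Virasoro

/-! ### An eigenvector of `l 0` when `k = 0` -/

section HighestWeight

variable {M : Type*} [AddCommGroup M] [Module ℂ M] [LieRingModule Virasoro M]
  [LieModule ℂ Virasoro M] {N₀ : Submodule ℂ M} {θ : ℂ}

theorem l_lie_word_mem_lower_zero (hc : ∀ v : M, ⁅c, v⁆ = θ • v)
    (hN0 : ∀ i : ℤ, 0 < i → ∀ n ∈ N₀, ⁅l i, n⁆ = 0)
    {zs : List ℤ} (hz : ∀ z ∈ zs, z ≤ 0) {n : M} (hn : n ∈ N₀) {p : ℤ} (hp : 0 < p) :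
    ⁅l p, word zs n⁆ ∈ lower 0 N₀ (zs.sum + p) (zs.length + 1) := by
  induction zs generalizing p with
  | nil =>
    rw [word_nil, hN0 p hp n hn]
    exact Submodule.zero_mem _
  | cons z zs ih =>
    have hzs : ∀ z ∈ zs, z ≤ 0 := fun z hz' => hz z (List.mem_cons_of_mem _ hz')
    have hz1 : z ≤ 0 := hz z List.mem_cons_self
    rw [word_cons, l_lie_l, hc, List.sum_cons, List.length_cons]
    push_cast
    refine Submodule.add_mem _ (Submodule.add_mem _ ?_ (Submodule.smul_mem _ _ ?_)) ?_
    · exact lower_mono (by lia) (l_lie_mem_lower hz1 (ih hzs hp))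
    · by_cases h : p + z ≤ 0
      · rw [← word_cons]
        refine word_mem_wordSpan (by simpa using ⟨h, hzs⟩) hn ?_
        simp only [List.sum_cons, List.length_cons]
        push_cast
        lia
      · exact lower_mono (by lia) (ih hzs (p := p + z) (by lia))
    · by_cases h : p + z = 0
      · exact Submodule.smul_mem _ _ (Submodule.smul_mem _ _ (word_mem_wordSpan hzs hn (by lia)))
      · rw [centralCoeff_of_ne h, zero_smul]; exact Submodule.zero_mem _

/-- With no letter below `-p`, only `⁅l p, l (-p)⁆ = -2p l 0 + …` keeps the length. Any other
nonzero commutator has positive index, and must consume another letter or die on `n`. -/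
theorem l_lie_word_add_mem_lower_zero (hc : ∀ v : M, ⁅c, v⁆ = θ • v)
    (hN0 : ∀ i : ℤ, 0 < i → ∀ n ∈ N₀, ⁅l i, n⁆ = 0)
    {p : ℤ} (hp : 0 < p) {zs : List ℤ} (hz : ∀ z ∈ zs, z ≤ 0) (hzp : ∀ z ∈ zs, -p ≤ z)
    {n : M} (hn : n ∈ N₀) :
    ⁅l p, word zs n⁆ + (2 * p : ℂ) • replaceSum (-p) [0] n zs ∈
      lower 0 N₀ (zs.sum + p) zs.length := by
  induction zs with
  | nil =>
    rw [word_nil, hN0 p hp n hn, replaceSum, smul_zero, add_zero]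
    exact Submodule.zero_mem _
  | cons z zs ih =>
    have hzs : ∀ z ∈ zs, z ≤ 0 := fun z hz' => hz z (List.mem_cons_of_mem _ hz')
    have hz1 : z ≤ 0 := hz z List.mem_cons_self
    have h1 := l_lie_mem_lower hz1 (ih hzs fun z hz' => hzp z (List.mem_cons_of_mem _ hz'))
    rw [lie_add, lie_smul] at h1
    have e1 : (z :: zs).sum + p = z + (zs.sum + p) := by rw [List.sum_cons]; ring
    have e2 : (((z :: zs).length : ℕ) : ℤ) = zs.length + 1 := by
      rw [List.length_cons]; push_cast; ring
    rw [e1, e2, word_cons, l_lie_l, hc, replaceSum]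
    by_cases h : z = -p
    · subst h
      have h2 : word zs n ∈ lower 0 N₀ (-p + (zs.sum + p)) (zs.length + 1) :=
        word_mem_wordSpan hzs hn (by lia)
      rw [if_pos rfl, List.singleton_append, word_cons, add_neg_cancel]
      convert Submodule.add_mem _ h1 (Submodule.smul_mem _ (centralCoeff p (-p) * θ) h2) using 1
      push_cast
      module
    · have hgt : -p < z := lt_of_le_of_ne (hzp z List.mem_cons_self) (Ne.symm h)
      rw [if_neg h, add_zero, centralCoeff_of_ne (by lia), zero_smul, add_zero]
      have h2 := lower_mono (σ' := z + (zs.sum + p)) (m' := zs.length + 1) (by lia)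
        (l_lie_word_mem_lower_zero hc hN0 hzs hn (p := p + z) (by lia))
      convert Submodule.add_mem _ h1 (Submodule.smul_mem _ ((z : ℂ) - p) h2) using 1
      module

theorem l_lie_mem_lower_zero (hc : ∀ v : M, ⁅c, v⁆ = θ • v)
    (hN0 : ∀ i : ℤ, 0 < i → ∀ n ∈ N₀, ⁅l i, n⁆ = 0) {p : ℤ} (hp : 0 < p) {σ m : ℤ} {w : M}
    (hw : w ∈ lower 0 N₀ σ m) : ⁅l p, w⁆ ∈ lower 0 N₀ (σ + p) m :=
  lie_mem_of_mem_wordSpan (fun _ _ hz hn _ =>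
    lower_mono (by lia) (l_lie_word_mem_lower_zero hc hN0 hz hn hp)) hw

theorem l_lie_monomial_add_mem_lower_zero (hc : ∀ v : M, ⁅c, v⁆ = θ • v)
    (hN0 : ∀ i : ℤ, 0 < i → ∀ n ∈ N₀, ⁅l i, n⁆ = 0)
    {s : Multiset ℤ} {p : ℤ} (hp : 0 < p) (hs : ∀ z ∈ s, z ≤ 0) (hsp : ∀ z ∈ s, -p ≤ z)
    {n : M} (hn : n ∈ N₀) :
    ⁅l p, word s.toList n⁆ +
        ((2 * p : ℂ) * s.count (-p)) • word (0 ::ₘ s.erase (-p)).toList n ∈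
      lower 0 N₀ (s.sum + p) s.card := by
  classical
  have hz : ∀ z ∈ s.toList, z ≤ 0 := fun z hz => hs z (Multiset.mem_toList.1 hz)
  have h1 := l_lie_word_add_mem_lower_zero hc hN0 hp hz
    (fun z hz => hsp z (Multiset.mem_toList.1 hz)) hn
  have h2 := replaceSum_sub_mem_lower le_rfl (q := -p) (by lia) (pre := [0]) hn (by simp) hz
  have hcount : s.toList.count (-p) = s.count (-p) := by
    rw [← Multiset.coe_count, Multiset.coe_toList]
  rw [hcount, List.singleton_append, List.sum_singleton, List.length_singleton] at h2
  rw [Multiset.sum_toList, Multiset.length_toList] at h1 h2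
  have h3 : (s.count (-p) : ℂ) • (word (0 :: s.toList.erase (-p)) n -
      word (0 ::ₘ s.erase (-p)).toList n) ∈ lower 0 N₀ (s.sum + p) s.card := by
    by_cases hmem : -p ∈ s
    · have hperm : (0 :: s.toList.erase (-p)).Perm (0 ::ₘ s.erase (-p)).toList := by
        rw [← Multiset.coe_eq_coe, ← Multiset.cons_coe, ← Multiset.coe_erase, Multiset.coe_toList,
          Multiset.coe_toList]
      have h := word_sub_word_mem_lower le_rfl hperm (fun z hz' => by
        rcases List.mem_cons.1 hz' with rfl | hz'
        · exact le_rfl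
        · exact hz z (List.mem_of_mem_erase hz')) hn
      rw [hperm.sum_eq, hperm.length_eq, Multiset.sum_toList, Multiset.length_toList,
        Multiset.sum_cons, Multiset.card_cons] at h
      have e1 : -p + (s.erase (-p)).sum = s.sum := by
        rw [← Multiset.sum_cons, Multiset.cons_erase hmem]
      have e2 := Multiset.card_erase_add_one hmem
      exact Submodule.smul_mem _ _ (lower_mono (by lia) h)
    · rw [Multiset.count_eq_zero_of_notMem hmem, Nat.cast_zero, zero_smul]
      exact Submodule.zero_mem _
  have h4 := Submodule.sub_mem _ h1 (Submodule.smul_mem _ (2 * p : ℂ)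
    (Submodule.add_mem _ (lower_mono (σ' := s.sum + p) (m' := s.card) (by push_cast; lia) h2) h3))
  convert h4 using 1
  module

open Polynomial in
-- Degree `0` forces every letter to be `0`, so this lower part consists of polynomials in `l 0` of
-- degree less than `m` applied to `v`.
theorem eq_zero_of_smul_word_replicate_mem_lower {v : M}
    (hp : ∀ q : ℂ[X], q ≠ 0 → aeval (LieModule.toEnd ℂ Virasoro M (l 0)) q v ≠ 0) {m : ℕ} {a : ℂ}
    (h : a • word (List.replicate m 0) v ∈ lower 0 (ℂ ∙ v) 0 m) : a = 0 := by
  set T := LieModule.toEnd ℂ Virasoro M (l 0) with hT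
  have hword : ∀ e : ℕ, word (List.replicate e 0) v = (T ^ e) v := by
    intro e
    rw [word, List.map_replicate, List.prod_replicate]
  let S := (degreeLT ℂ m).map (LinearMap.applyₗ v ∘ₗ (aeval T).toLinearMap)
  have hS : lower 0 (ℂ ∙ v) 0 m ≤ S := by
    refine Submodule.span_le.2 ?_
    rintro _ ⟨zs, n, hz, hn, h, rfl⟩
    obtain ⟨a, rfl⟩ := Submodule.mem_span_singleton.1 hn
    have hsum := list_sum_nonpos hz
    have hzero : ∀ zs : List ℤ, (∀ z ∈ zs, z ≤ 0) → zs.sum = 0 →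
        zs = List.replicate zs.length 0 := by
      intro zs
      induction zs with
      | nil => intro _ _; rfl
      | cons z zs ih =>
        intro hz hs
        have h1 := list_sum_nonpos fun y hy => hz y (List.mem_cons_of_mem _ hy)
        have h2 := hz z List.mem_cons_self
        rw [List.sum_cons] at hs
        rw [List.length_cons, List.replicate_succ, ← ih
          (fun y hy => hz y (List.mem_cons_of_mem _ hy)) (by lia), show z = 0 by lia]
    rw [hzero zs hz (by lia), map_smul, hword]
    refine S.smul_mem a ⟨X ^ zs.length, ?_, ?_⟩
    · rw [SetLike.mem_coe, mem_degreeLT, degree_X_pow]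
      exact_mod_cast (show zs.length < m by lia)
    · simp
  obtain ⟨q, hq, hqa⟩ := hS h
  by_contra ha
  rw [SetLike.mem_coe, mem_degreeLT] at hq
  refine hp (C a * X ^ m - q) (fun h0 => ?_) ?_
  · have := congrArg (fun r => r.coeff m) h0
    simp only [coeff_sub, coeff_C_mul, coeff_X_pow, if_true, mul_one, coeff_zero,
      coeff_eq_zero_of_degree_lt hq, sub_zero] at this
    exact ha this
  · have hqa' : aeval T q v = a • (T ^ m) v := by rw [← hword]; exact hqa
    rw [map_sub, LinearMap.sub_apply, hqa', map_mul, map_pow, aeval_X, aeval_C,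
      Module.End.mul_apply, Module.algebraMap_end_apply, sub_self]

open Polynomial in
-- With `-p` the least letter occurring, `l p` turns one `-p` into `0`, keeping the length and
-- raising the degree towards `0`. The induction ends at powers of `l 0`, where `hp` applies.
theorem eq_zero_of_sum_mem_lower_zero (hc : ∀ v : M, ⁅c, v⁆ = θ • v) {v : M}
    (hv : ∀ i : ℤ, 0 < i → ⁅l i, v⁆ = 0)
    (hp : ∀ q : ℂ[X], q ≠ 0 → aeval (LieModule.toEnd ℂ Virasoro M (l 0)) q v ≠ 0)
    {σ : ℤ} {m : ℕ} {A : Finset (Multiset ℤ)}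
    (hA : ∀ s ∈ A, (∀ z ∈ s, z ≤ 0) ∧ s.sum = σ ∧ s.card = m) {f : Multiset ℤ → ℂ}
    (hsum : ∑ s ∈ A, f s • word s.toList v ∈ lower 0 (ℂ ∙ v) σ m) : ∀ s ∈ A, f s = 0 := by
  classical
  have hN0 : ∀ i : ℤ, 0 < i → ∀ n ∈ (ℂ ∙ v), ⁅l i, n⁆ = 0 := by
    intro i hi n hn
    obtain ⟨a, rfl⟩ := Submodule.mem_span_singleton.1 hn
    rw [lie_smul, hv i hi, smul_zero]
  have hvv : v ∈ (ℂ ∙ v) := Submodule.mem_span_singleton_self v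
  obtain ⟨d, hd⟩ : ∃ d : ℕ, (-σ).toNat = d := ⟨_, rfl⟩
  induction d using Nat.strong_induction_on generalizing σ A f with
  | _ d ih =>
    -- One step only controls the monomials containing the least letter. With zero coefficients
    -- discarded, a single vanishing coefficient is already a contradiction.
    wlog hne : ∀ s ∈ A, f s ≠ 0 generalizing A
    · by_contra! hcon
      obtain ⟨s, hs, hs0⟩ := hcon
      refine hs0 (this (A := A.filter fun s => f s ≠ 0) (fun s hs => ?_) ?_ (fun s hs => ?_) s ?_)
      · exact hA s (Finset.mem_filter.1 hs).1
      · have hfilter : ∑ s ∈ A with f s ≠ 0, f s • word s.toList v =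
            ∑ s ∈ A, f s • word s.toList v :=
          Finset.sum_filter_of_ne fun s _ h h0 => h (by rw [h0, zero_smul])
        rwa [hfilter]
      · exact (Finset.mem_filter.1 hs).2
      · exact Finset.mem_filter.2 ⟨hs, hs0⟩
    intro s₀ hs₀
    have hzeros : ∀ s : Multiset ℤ, (∀ z ∈ s, 0 ≤ z) → (∀ z ∈ s, z ≤ 0) →
        s.toList = List.replicate s.card 0 := by
      intro s h1 h2
      rw [List.eq_replicate_iff, Multiset.length_toList]
      refine ⟨rfl, fun z hz => ?_⟩
      rw [Multiset.mem_toList] at hz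
      exact le_antisymm (h2 z hz) (h1 z hz)
    by_cases hneg : ∃ s ∈ A, ∃ z ∈ s, z < 0
    · exfalso
      obtain ⟨s₁, hs₁, z₁, hz₁, hz₁0⟩ := hneg
      obtain ⟨z, hz, hmin⟩ := (A.biUnion fun s => s.toFinset).exists_min_image id
        ⟨z₁, Finset.mem_biUnion.2 ⟨s₁, hs₁, Multiset.mem_toFinset.2 hz₁⟩⟩
      have hmin' : ∀ s ∈ A, ∀ y ∈ s, z ≤ y := fun s hs y hy =>
        hmin y (Finset.mem_biUnion.2 ⟨s, hs, Multiset.mem_toFinset.2 hy⟩)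
      obtain ⟨t, ht, hzt⟩ := Finset.mem_biUnion.1 hz
      rw [Multiset.mem_toFinset] at hzt
      have hz0 : z < 0 := (hmin' s₁ hs₁ z₁ hz₁).trans_lt hz₁0
      obtain ⟨p, rfl⟩ : ∃ p, z = -p := ⟨-z, by ring⟩
      have hp0 : 0 < p := by lia
      have hp2 : (2 * p : ℂ) ≠ 0 := by
        have : (2 * p : ℤ) ≠ 0 := by lia
        exact_mod_cast this
      have h1 := l_lie_mem_lower_zero hc hN0 hp0 hsum
      have h2 : ∑ s ∈ A, (s.count (-p) : ℂ) • f s • word (0 ::ₘ s.erase (-p)).toList v ∈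
          lower 0 (ℂ ∙ v) (σ + p) m := by
        have h3 : ∑ s ∈ A, (⁅l p, f s • word s.toList v⁆ + (2 * p : ℂ) • ((s.count (-p) : ℂ) •
            f s • word (0 ::ₘ s.erase (-p)).toList v)) ∈ lower 0 (ℂ ∙ v) (σ + p) m := by
          refine Submodule.sum_mem _ fun s hs => ?_
          obtain ⟨ha, hb, hcard⟩ := hA s hs
          have := Submodule.smul_mem _ (f s)
            (l_lie_monomial_add_mem_lower_zero hc hN0 hp0 ha (hmin' s hs) hvv)
          rw [hb, hcard] at this
          convert this using 1
          rw [lie_smul]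
          module
        rw [Finset.sum_add_distrib, ← lie_sum, ← Finset.smul_sum] at h3
        exact (Submodule.smul_mem_iff _ hp2).1 ((Submodule.add_mem_iff_right _ h1).1 h3)
      have hback : ∀ s : Multiset ℤ, -p ∈ s → -p ::ₘ (0 ::ₘ s.erase (-p)).erase 0 = s := by
        intro s hs
        rw [Multiset.erase_cons_head, Multiset.cons_erase hs]
      have hinjOn : Set.InjOn (fun s : Multiset ℤ => 0 ::ₘ s.erase (-p))
          ((A.filter fun s => -p ∈ s : Finset (Multiset ℤ)) : Set (Multiset ℤ)) := by
        intro s hs t ht hst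
        rw [Finset.mem_coe, Finset.mem_filter] at hs ht
        rw [← hback s hs.2, ← hback t ht.2]
        exact congrArg (fun u : Multiset ℤ => -p ::ₘ u.erase 0) hst
      have hσ : σ + p ≤ 0 := by
        have e1 : -p + (t.erase (-p)).sum = t.sum := by
          rw [← Multiset.sum_cons, Multiset.cons_erase hzt]
        have e2 : (t.erase (-p)).sum ≤ 0 := by
          rw [← Multiset.sum_toList]
          exact list_sum_nonpos fun y hy =>
            (hA t ht).1 y (Multiset.mem_of_mem_erase (Multiset.mem_toList.1 hy))
        have := (hA t ht).2.1
        lia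
      have h5 := ih (-(σ + p)).toNat (by lia) (σ := σ + p)
        (A := (A.filter fun s => -p ∈ s).image fun s => 0 ::ₘ s.erase (-p))
        (f := fun t => ((-p ::ₘ t.erase 0).count (-p) : ℂ) * f (-p ::ₘ t.erase 0)) ?_ ?_ rfl
      · have h6 := h5 (0 ::ₘ t.erase (-p))
          (Finset.mem_image_of_mem _ (Finset.mem_filter.2 ⟨ht, hzt⟩))
        simp only [hback t hzt] at h6
        refine hne t ht ((mul_eq_zero.1 h6).resolve_left ?_)
        exact_mod_cast Multiset.count_ne_zero.2 hzt
      · intro t ht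
        obtain ⟨s, hs, rfl⟩ := Finset.mem_image.1 ht
        rw [Finset.mem_filter] at hs
        obtain ⟨ha, hb, hd⟩ := hA s hs.1
        have e1 : -p + (s.erase (-p)).sum = s.sum := by
          rw [← Multiset.sum_cons, Multiset.cons_erase hs.2]
        have e2 := Multiset.card_erase_add_one hs.2
        refine ⟨fun z hz => ?_, ?_, ?_⟩
        · rcases Multiset.mem_cons.1 hz with rfl | hz
          · exact le_rfl
          · exact ha z (Multiset.mem_of_mem_erase hz)
        · rw [Multiset.sum_cons]; lia
        · rw [Multiset.card_cons]; lia
      · rw [Finset.sum_image hinjOn, Finset.sum_filter]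
        convert h2 using 1
        refine Finset.sum_congr rfl fun s hs => ?_
        split_ifs with hmem
        · rw [hback s hmem, mul_smul]
        · rw [Multiset.count_eq_zero_of_notMem hmem, Nat.cast_zero, zero_smul]
    · push Not at hneg
      have hrep : ∀ s ∈ A, s.toList = List.replicate m 0 := fun s hs => by
        rw [hzeros s (hneg s hs) (hA s hs).1, (hA s hs).2.2]
      have hA' : A = {s₀} := by
        refine Finset.eq_singleton_iff_unique_mem.2 ⟨hs₀, fun s hs => ?_⟩
        rw [← Multiset.coe_toList s, ← Multiset.coe_toList s₀, hrep s hs, hrep s₀ hs₀]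
      have hσ : σ = 0 := by
        rw [← (hA s₀ hs₀).2.1, ← Multiset.sum_toList, hrep s₀ hs₀, List.sum_replicate, smul_zero]
      rw [hA', Finset.sum_singleton, hrep s₀ hs₀, hσ] at hsum
      exact eq_zero_of_smul_word_replicate_mem_lower hp hsum

theorem exists_eigenvector_l_zero (hM : LieModule.IsIrreducible ℂ Virasoro M)
    (hc : ∀ v : M, ⁅c, v⁆ = θ • v) {v : M} (hv : v ∈ annihilatedAbove M 0) (h0 : v ≠ 0) :
    ∃ (a : ℂ) (w : M), w ∈ annihilatedAbove M 0 ∧ w ≠ 0 ∧ ⁅l 0, w⁆ = a • w := by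
  classical
  by_contra! hne
  have hp : ∀ q : Polynomial ℂ, q ≠ 0 →
      Polynomial.aeval (LieModule.toEnd ℂ Virasoro M (l 0)) q v ≠ 0 := fun q hq h =>
    h0 (Module.End.eq_zero_of_aeval_eq_zero (W := (annihilatedAbove M 0).toSubmodule)
      (fun w hw => l_lie_mem_annihilatedAbove hw le_rfl)
      (fun a w hw h => by
        by_contra hw0
        exact hne a w hw hw0 h) hq hv h)
  have hv0 : ⁅l 0, v⁆ ≠ 0 := fun h => hne 0 v hv h0 (by rw [h, zero_smul])
  have hv' : ∀ i : ℤ, 0 < i → ⁅l i, v⁆ = 0 := fun i hi => hv i (by simpa using hi)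
  let j : ℂ →ₗ[ℂ] M := LinearMap.toSpanSingleton ℂ M ⁅l 0, v⁆
  have hj : ∀ a, j a = a • ⁅l 0, v⁆ := fun a => rfl
  have hN : ∀ i : ℤ, 0 < i → ∀ n ∈ LinearMap.range j, ⁅l i, n⁆ ∈ LinearMap.range j := by
    rintro i hi _ ⟨a, rfl⟩
    have := l_lie_mem_annihilatedAbove hv (i := 0) le_rfl i (by simpa using hi)
    rw [hj, lie_smul, this, smul_zero]
    exact Submodule.zero_mem _
  have htop := eq_top_of_stable hM _ (l_lie_mem_wordSpan_true hc hN) (w := ⁅l 0, v⁆)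
    (word_mem_wordSpan (zs := []) (by simp) ⟨1, one_smul ℂ _⟩ trivial) hv0
  obtain ⟨F, hF, hFv⟩ := exists_evalMon_eq le_rfl j (w := v) (by rw [htop]; trivial)
  have hF0 : F.support.Nonempty := by
    rw [Finsupp.support_nonempty_iff]
    rintro rfl
    exact h0 (by rw [← hFv, map_zero])
  obtain ⟨σ, m, ⟨s₀, hs₀, hσ, hm⟩, hlead⟩ := exists_leading hF0
  have hswap : ∀ s ∈ F.support, word s.toList ⁅l 0, v⁆ - word (0 ::ₘ s).toList v ∈
      lower 0 (ℂ ∙ v) s.sum (s.card + 1) := by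
    intro s hs
    have hperm : (s.toList ++ [0]).Perm (0 ::ₘ s).toList := by
      rw [← Multiset.coe_eq_coe, ← Multiset.coe_add, Multiset.coe_toList, Multiset.coe_toList,
        Multiset.coe_singleton, add_comm, Multiset.singleton_add]
    have h := word_sub_word_mem_lower le_rfl hperm (fun z hz => by
      rcases List.mem_append.1 hz with hz | hz
      · exact hF s hs z (Multiset.mem_toList.1 hz)
      · exact (List.mem_singleton.1 hz).le) (Submodule.mem_span_singleton_self v)
    rw [hperm.sum_eq, hperm.length_eq, Multiset.sum_toList, Multiset.length_toList,
      Multiset.sum_cons, Multiset.card_cons, zero_add, word_append, word_cons, word_nil] at h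
    exact_mod_cast h
  have hmem : ∀ s ∈ F.support, word (0 ::ₘ s).toList v ∈
      wordSpan 0 (ℂ ∙ v) fun t r => t = s.sum ∧ r = s.card + 1 := by
    intro s hs
    refine word_mem_wordSpan (fun z hz => ?_) (Submodule.mem_span_singleton_self v) ?_
    · rcases Multiset.mem_cons.1 (Multiset.mem_toList.1 hz) with rfl | hz
      · exact le_rfl
      · exact hF s hs z hz
    · rw [Multiset.sum_toList, Multiset.length_toList, Multiset.sum_cons, Multiset.card_cons]
      push_cast
      exact ⟨zero_add _, rfl⟩
  have hinj : Set.InjOn (fun s : Multiset ℤ => 0 ::ₘ s)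
      ((F.support.filter fun s => s.sum = σ ∧ s.card = m : Finset _) : Set (Multiset ℤ)) :=
    fun s _ t _ h => (Multiset.cons_inj_right 0).1 h
  have hkey := eq_zero_of_sum_mem_lower_zero hc hv' hp (σ := σ) (m := m + 1)
    (A := (F.support.filter fun s => s.sum = σ ∧ s.card = m).image fun s => 0 ::ₘ s)
    (f := fun s => F (s.erase 0)) ?_ ?_
  · have := hkey (0 ::ₘ s₀) (Finset.mem_image_of_mem _ (Finset.mem_filter.2 ⟨hs₀, hσ, hm⟩))
    simp only [Multiset.erase_cons_head] at this
    exact Finsupp.mem_support_iff.1 hs₀ this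
  · intro t ht
    obtain ⟨s, hs, rfl⟩ := Finset.mem_image.1 ht
    rw [Finset.mem_filter] at hs
    refine ⟨fun z hz => ?_, ?_, ?_⟩
    · rcases Multiset.mem_cons.1 hz with rfl | hz
      · exact le_rfl
      · exact hF s hs.1 z hz
    · rw [Multiset.sum_cons, hs.2.1, zero_add]
    · rw [Multiset.card_cons, hs.2.2]
  · rw [Finset.sum_image hinj]
    simp only [Multiset.erase_cons_head]
    have h1 : v - ∑ s ∈ F.support, F s • word (0 ::ₘ s).toList v ∈
        lower 0 (ℂ ∙ v) σ (m + 1 : ℕ) := by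
      have hFv' : v - ∑ s ∈ F.support, F s • word (0 ::ₘ s).toList v =
          ∑ s ∈ F.support, word s.toList (j (F s)) -
            ∑ s ∈ F.support, F s • word (0 ::ₘ s).toList v := by rw [← evalMon_apply, hFv]
      rw [hFv', ← Finset.sum_sub_distrib]
      refine Submodule.sum_mem _ fun s hs => ?_
      rw [hj, map_smul, ← smul_sub]
      have := hlead s hs
      exact Submodule.smul_mem _ _ (lower_mono (by push_cast; lia) (hswap s hs))
    -- The empty word has degree `0 ≥ σ` and length `0 < m + 1`, so `v` cannot cancel the leading
    -- part, whose monomials each gained a factor `l 0`.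
    have h2 : v ∈ lower 0 (ℂ ∙ v) σ (m + 1 : ℕ) := by
      refine word_mem_wordSpan (zs := []) (by simp) (Submodule.mem_span_singleton_self v) ?_
      have : s₀.sum ≤ 0 := by
        rw [← Multiset.sum_toList]
        exact list_sum_nonpos fun y hy => hF s₀ hs₀ y (Multiset.mem_toList.1 hy)
      simp only [List.sum_nil, List.length_nil]
      push_cast
      lia
    have h3 := (Submodule.sub_mem_iff_right _ h2).1 h1
    rw [← Finset.sum_filter_add_sum_filter_not F.support fun s => s.sum = σ ∧ s.card = m] at h3
    refine (Submodule.add_mem_iff_left _ (Submodule.sum_mem _ fun s hs => ?_)).1 h3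
    rw [Finset.mem_filter] at hs
    have h4 := hlead s hs.1
    exact Submodule.smul_mem _ _ (wordSpan_mono (fun t r h => by push_cast; lia) (hmem s hs.1))

end HighestWeight

end Virasoro

/-- The universal property gives a map into `S` whose composite with the inclusion is the identity.
-/
theorem UniversalEnvelopingAlgebra.subalgebra_eq_top {𝔤 : Type*} [LieRing 𝔤] [LieAlgebra ℂ 𝔤]
    (S : Subalgebra ℂ (UniversalEnvelopingAlgebra ℂ 𝔤))
    (h : ∀ x : 𝔤, UniversalEnvelopingAlgebra.ι ℂ x ∈ S) : S = ⊤ := by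
  let f : 𝔤 →ₗ⁅ℂ⁆ S :=
    { toFun := fun x => ⟨UniversalEnvelopingAlgebra.ι ℂ x, h x⟩
      map_add' := fun x y => Subtype.ext (map_add _ x y)
      map_smul' := fun a x => Subtype.ext (map_smul _ a x)
      map_lie' := fun {x y} => Subtype.ext (LieHom.map_lie _ x y) }
  have hf : S.val.comp (UniversalEnvelopingAlgebra.lift ℂ f) = AlgHom.id ℂ _ := by
    ext x
    change ((UniversalEnvelopingAlgebra.lift ℂ f (UniversalEnvelopingAlgebra.ι ℂ x) : S) :
      UniversalEnvelopingAlgebra ℂ 𝔤) = UniversalEnvelopingAlgebra.ι ℂ x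
    rw [UniversalEnvelopingAlgebra.lift_ι_apply]
    rfl
  refine eq_top_iff.2 fun u _ => ?_
  have := DFunLike.congr_fun hf u
  change ((UniversalEnvelopingAlgebra.lift ℂ f u : S) : UniversalEnvelopingAlgebra ℂ 𝔤) = u at this
  rw [← this]
  exact Subtype.property _

namespace Virasoro

/-! ### Spanning monomials in `Ind_θ(N)` -/

section IndTheta

variable {N : Type u} [AddCommGroup N] [Module ℂ N] [LieRingModule plus N] [LieModule ℂ plus N]
  {θ : ℂ}

theorem IndTheta.c_lie (m : IndTheta N θ) : ⁅c, m⁆ = θ • m := by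
  obtain ⟨t, rfl⟩ := (centralRel N θ).mkQ_surjective m
  have h : IndTheta.mk N θ ((UniversalEnvelopingAlgebra.ι ℂ c - algebraMap ℂ U θ) • t) = 0 :=
    (Submodule.Quotient.mk_eq_zero _).2 (Submodule.subset_span ⟨t, rfl⟩)
  rw [map_smul, sub_smul, sub_eq_zero, algebraMap_smul] at h
  exact h

variable (N θ) in
/-- The linear map `x ↦ 1 ⊗ x`. -/
noncomputable def IndTheta.oneTmulₗ : N →ₗ[ℂ] IndTheta N θ where
  toFun := IndTheta.oneTmul θ
  map_add' x y := by
    rw [IndTheta.oneTmul, TensorProduct.tmul_add, map_add, map_add]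
    rfl
  map_smul' a x := by
    have h : (1 : U) ⊗ₜ[ℂ] (a • x) = algebraMap ℂ U a • ((1 : U) ⊗ₜ[ℂ] x) := by
      rw [TensorProduct.tmul_smul, algebraMap_smul]
    rw [IndTheta.oneTmul, h, map_smul, map_smul, algebraMap_smul]
    rfl

theorem IndTheta.oneTmulₗ_apply (x : N) : IndTheta.oneTmulₗ N θ x = IndTheta.oneTmul θ x := rfl

theorem IndTheta.lie_oneTmul (a : plus) (x : N) :
    ⁅(a : Virasoro), IndTheta.oneTmul θ x⁆ = IndTheta.oneTmul θ ⁅a, x⁆ := by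
  have h : (indRel N).mkQ ((1 * UPlus.toU (UniversalEnvelopingAlgebra.ι ℂ a)) ⊗ₜ[ℂ] x) =
      (indRel N).mkQ ((1 : U) ⊗ₜ[ℂ] (UPlus.act N (UniversalEnvelopingAlgebra.ι ℂ a) x)) := by
    rw [← sub_eq_zero, ← map_sub]
    exact (Submodule.Quotient.mk_eq_zero _).2 (Submodule.subset_span ⟨1, _, x, rfl⟩)
  have h1 : UPlus.toU (UniversalEnvelopingAlgebra.ι ℂ a) =
      UniversalEnvelopingAlgebra.ι ℂ (a : Virasoro) :=
    UniversalEnvelopingAlgebra.lift_ι_apply ℂ _ a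
  have h2 : UPlus.act N (UniversalEnvelopingAlgebra.ι ℂ a) x = ⁅a, x⁆ := by
    rw [UPlus.act, UniversalEnvelopingAlgebra.lift_ι_apply]
    rfl
  rw [h1, h2, one_mul] at h
  rw [IndTheta.oneTmul, IndTheta.oneTmul, ← h, IndTheta.lie_def, ← map_smul, ← map_smul,
    TensorProduct.smul_tmul', smul_eq_mul, mul_one]

theorem IndTheta.eq_top_of_stable (W : Submodule ℂ (IndTheta N θ))
    (hl : ∀ i : ℤ, ∀ w ∈ W, ⁅l i, w⁆ ∈ W) (h1 : ∀ x : N, IndTheta.oneTmul θ x ∈ W) : W = ⊤ := by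
  let S : Subalgebra ℂ U :=
    { carrier := {u | ∀ w ∈ W, u • w ∈ W}
      mul_mem' := fun {a b} ha hb w hw => by rw [mul_smul]; exact ha _ (hb w hw)
      add_mem' := fun {a b} ha hb w hw => by rw [add_smul]; exact W.add_mem (ha w hw) (hb w hw)
      algebraMap_mem' := fun a w hw => by rw [algebraMap_smul]; exact W.smul_mem a hw }
  have hS : S = ⊤ := UniversalEnvelopingAlgebra.subalgebra_eq_top S
    fun x w hw => l_mem_lie_stable hl x hw
  refine eq_top_iff.2 fun m _ => ?_
  obtain ⟨t, rfl⟩ := (centralRel N θ).mkQ_surjective m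
  obtain ⟨t, rfl⟩ := (indRel N).mkQ_surjective t
  induction t using TensorProduct.induction_on with
  | zero => rw [map_zero, map_zero]; exact W.zero_mem
  | add x y hx hy => rw [map_add, map_add]; exact W.add_mem (hx trivial) (hy trivial)
  | tmul w x =>
    have hw : w ∈ S := by rw [hS]; trivial
    have : w ⊗ₜ[ℂ] x = w • ((1 : U) ⊗ₜ[ℂ] x) := by
      rw [TensorProduct.smul_tmul', smul_eq_mul, mul_one]
    rw [this, map_smul, map_smul]
    exact hw _ (h1 x)

theorem IndTheta.l_lie_mem_range (i : ℤ) (hi : -1 < i) (m : IndTheta N θ)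
    (hm : m ∈ LinearMap.range (IndTheta.oneTmulₗ N θ)) :
    ⁅l i, m⁆ ∈ LinearMap.range (IndTheta.oneTmulₗ N θ) := by
  obtain ⟨x, rfl⟩ := hm
  exact ⟨⁅(⟨l i, mem_plus_of_nonneg (by lia)⟩ : plus), x⁆,
    (IndTheta.lie_oneTmul (⟨l i, mem_plus_of_nonneg (by lia)⟩ : plus) x).symm⟩

theorem IndTheta.exists_evalMon_eq (m : IndTheta N θ) :
    ∃ F : Multiset ℤ →₀ N, (∀ s ∈ F.support, ∀ z ∈ s, z ≤ -1) ∧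
      evalMon (IndTheta.oneTmulₗ N θ) F = m := by
  refine Virasoro.exists_evalMon_eq (by norm_num) _ ?_
  rw [IndTheta.eq_top_of_stable _ (l_lie_mem_wordSpan_true IndTheta.c_lie IndTheta.l_lie_mem_range)
    fun x => word_mem_wordSpan (zs := []) (by simp) ⟨x, rfl⟩ trivial]
  trivial

end IndTheta

/-! ### The canonical homomorphism and the simplicity of `N` -/

section CanonicalHom

variable {L : Type u} [AddCommGroup L] [Module ℂ L] [LieRingModule Virasoro L]
  [LieModule ℂ Virasoro L] {θ : ℂ}

variable (L) in
/-- The action of `U(𝔙)` on a module over the Virasoro algebra. -/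
noncomputable def U.act : U →ₐ[ℂ] Module.End ℂ L :=
  UniversalEnvelopingAlgebra.lift ℂ (LieModule.toEnd ℂ Virasoro L)

theorem U.act_ι (x : Virasoro) (v : L) : U.act L (UniversalEnvelopingAlgebra.ι ℂ x) v = ⁅x, v⁆ := by
  rw [U.act, UniversalEnvelopingAlgebra.lift_ι_apply]
  rfl

theorem U.act_toU (N : LieSubmodule ℂ plus L) (a : UPlus) (x : N) :
    U.act L (UPlus.toU a) (x : L) = (UPlus.act N a x : N) := by
  let S : Subalgebra ℂ UPlus :=
    { carrier := {a | ∀ x : N, U.act L (UPlus.toU a) (x : L) = (UPlus.act N a x : N)}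
      mul_mem' := fun {a b} ha hb x => by
        rw [map_mul, map_mul, map_mul, Module.End.mul_apply, Module.End.mul_apply, hb, ha]
      add_mem' := fun {a b} ha hb x => by
        rw [map_add, map_add, map_add, LinearMap.add_apply, LinearMap.add_apply, hb, ha]
        rfl
      algebraMap_mem' := fun a x => by
        rw [AlgHom.commutes, AlgHom.commutes, AlgHom.commutes, Module.algebraMap_end_apply,
          Module.algebraMap_end_apply]
        rfl }
  have hS : S = ⊤ := UniversalEnvelopingAlgebra.subalgebra_eq_top S fun y x => by
    rw [UPlus.toU, UniversalEnvelopingAlgebra.lift_ι_apply, UPlus.act,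
      UniversalEnvelopingAlgebra.lift_ι_apply]
    exact U.act_ι _ _
  have ha : a ∈ S := by rw [hS]; trivial
  exact ha x

theorem exists_indTheta_hom (N : LieSubmodule ℂ plus L) (hc : ∀ v : L, ⁅c, v⁆ = θ • v) :
    ∃ φ : IndTheta N θ →ₗ⁅ℂ, Virasoro⁆ L, ∀ x : N, φ (IndTheta.oneTmul θ x) = (x : L) := by
  let : Module U L := Module.compHom L (U.act L).toRingHom
  have hU : ∀ (w : U) (v : L), w • v = U.act L w v := fun _ _ => rfl
  let ψ : U ⊗[ℂ] N →ₗ[ℂ] L :=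
    TensorProduct.lift ((LinearMap.lcomp ℂ L N.toSubmodule.subtype) ∘ₗ (U.act L).toLinearMap)
  have hψ : ∀ (w : U) (x : N), ψ (w ⊗ₜ[ℂ] x) = U.act L w (x : L) := fun w x => rfl
  let ψU : U ⊗[ℂ] N →ₗ[U] L :=
    { toFun := ψ
      map_add' := map_add ψ
      map_smul' := fun w t => by
        rw [RingHom.id_apply, hU]
        induction t using TensorProduct.induction_on with
        | zero => rw [smul_zero, map_zero, map_zero]
        | add x y hx hy => rw [smul_add, map_add, map_add, map_add, hx, hy]
        | tmul w' x =>
          rw [TensorProduct.smul_tmul', smul_eq_mul, hψ, hψ, map_mul, Module.End.mul_apply] }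
  have h1 : indRel N ≤ LinearMap.ker ψU := by
    refine Submodule.span_le.2 ?_
    rintro _ ⟨w, a, x, rfl⟩
    change ψU _ = 0
    rw [map_sub, sub_eq_zero]
    change ψ _ = ψ _
    rw [hψ, hψ, map_mul, Module.End.mul_apply, U.act_toU]
  have h2 : centralRel N θ ≤ LinearMap.ker ((indRel N).liftQ ψU h1) := by
    refine Submodule.span_le.2 ?_
    rintro _ ⟨t, rfl⟩
    change (indRel N).liftQ ψU h1 _ = 0
    rw [map_smul, hU, map_sub, LinearMap.sub_apply, U.act_ι, hc, AlgHom.commutes,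
      Module.algebraMap_end_apply, sub_self]
  let φU : IndTheta N θ →ₗ[U] L := (centralRel N θ).liftQ _ h2
  refine ⟨{ toFun := φU, map_add' := map_add φU, map_smul' := ?_, map_lie' := ?_ }, ?_⟩
  · intro a m
    rw [RingHom.id_apply, ← algebraMap_smul U a m, map_smul, hU, AlgHom.commutes,
      Module.algebraMap_end_apply]
  · intro x m
    rw [IndTheta.lie_def, map_smul, hU, U.act_ι]
  · intro x
    change ψ ((1 : U) ⊗ₜ[ℂ] x) = x
    rw [hψ, map_one, Module.End.one_apply]

theorem map_word {M M' : Type*} [AddCommGroup M] [Module ℂ M] [LieRingModule Virasoro M]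
    [LieModule ℂ Virasoro M] [AddCommGroup M'] [Module ℂ M'] [LieRingModule Virasoro M']
    [LieModule ℂ Virasoro M'] (φ : M →ₗ⁅ℂ, Virasoro⁆ M') (zs : List ℤ) (v : M) :
    φ (word zs v) = word zs (φ v) := by
  induction zs with
  | nil => rfl
  | cons z zs ih => rw [word_cons, word_cons, LieModuleHom.map_lie, ih]

variable {k : ℕ}

theorem l_lie_mem_annihilatedAbove_toSubmodule (i : ℤ) (hi : -1 < i) (n : L)
    (hn : n ∈ (annihilatedAbove L k).toSubmodule) :
    ⁅l i, n⁆ ∈ (annihilatedAbove L k).toSubmodule :=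
  l_lie_mem_annihilatedAbove hn (by lia)

theorem annihilatedAbove_isIrreducible (hL : LieModule.IsIrreducible ℂ Virasoro L) (hk : 0 < k)
    (hc : ∀ v : L, ⁅c, v⁆ = θ • v) (hinj : ∀ n ∈ annihilatedAbove L k, ⁅l k, n⁆ = 0 → n = 0)
    {v : L} (hv : v ∈ annihilatedAbove L k) (h0 : v ≠ 0) :
    LieModule.IsIrreducible ℂ plus (annihilatedAbove L k) := by
  classical
  have : Nontrivial (annihilatedAbove L k) := ⟨⟨v, hv⟩, 0, fun h => h0 (congrArg Subtype.val h)⟩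
  refine LieModule.IsIrreducible.mk fun N' hN' => ?_
  obtain ⟨n, hn, hn0⟩ : ∃ n ∈ N', n ≠ 0 := by
    by_contra! h
    exact hN' ((LieSubmodule.eq_bot_iff N').2 h)
  let j : N' →ₗ[ℂ] L := (annihilatedAbove L k).toSubmodule.subtype ∘ₗ N'.toSubmodule.subtype
  have hj : ∀ y : N', j y = ((y : annihilatedAbove L k) : L) := fun _ => rfl
  have hN : ∀ i : ℤ, -1 < i → ∀ y ∈ LinearMap.range j, ⁅l i, y⁆ ∈ LinearMap.range j := by
    rintro i hi _ ⟨y, rfl⟩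
    exact ⟨⁅(⟨l i, mem_plus_of_nonneg (by lia)⟩ : plus), y⁆, rfl⟩
  have htop := eq_top_of_stable hL _ (l_lie_mem_wordSpan_true hc hN) (w := (n : L))
    (word_mem_wordSpan (zs := []) (by simp) ⟨⟨n, hn⟩, rfl⟩ trivial)
    (fun h => hn0 (Subtype.ext h))
  refine eq_top_iff.2 fun x _ => ?_
  obtain ⟨F, hF, hFx⟩ := exists_evalMon_eq (b := -1) (by norm_num) j (w := (x : L)) (by rw [htop]; trivial)
  -- Words on `N'` already span `L`. Subtracting `x` at the empty monomial gives a zero sum with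
  -- coefficients in `N`, so `x` is the coefficient `F 0`, which lies in `N'`.
  have key := eq_zero_of_sum_eq_zero (N₀ := (annihilatedAbove L k).toSubmodule) hk hc
    l_lie_mem_annihilatedAbove_toSubmodule (fun i hi n hn => hn i hi) hinj
    (A := insert 0 F.support) (f := fun s => j (F s) - if s = 0 then (x : L) else 0) ?_ ?_ ?_ 0
    (Finset.mem_insert_self _ _)
  · rw [if_pos rfl, sub_eq_zero, hj] at key
    have : (F 0 : annihilatedAbove L k) = x := Subtype.ext key
    rw [← this]
    exact (F 0).2
  · intro s hs z hz
    rcases Finset.mem_insert.1 hs with rfl | hs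
    · simp at hz
    · exact hF s hs z hz
  · intro s _
    refine Submodule.sub_mem _ (F s : annihilatedAbove L k).2 ?_
    split_ifs
    · exact x.2
    · exact Submodule.zero_mem _
  · simp only [map_sub]
    rw [Finset.sum_sub_distrib, sub_eq_zero]
    trans (x : L)
    · rw [← hFx, evalMon_apply]
      refine (Finset.sum_subset (Finset.subset_insert _ _) fun s _ hs => ?_).symm
      rw [Finsupp.notMem_support_iff.1 hs, map_zero, map_zero]
    · rw [Finset.sum_eq_single 0]
      · rw [if_pos rfl, Multiset.toList_zero, word_nil]
      · intro s _ hs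
        rw [if_neg hs, map_zero]
      · exact fun h => absurd (Finset.mem_insert_self _ _) h

/-- Monomials span the source and their images are independent over `N`, which gives injectivity;
the range is a nonzero submodule of a simple module. -/
theorem exists_indTheta_equiv (hL : LieModule.IsIrreducible ℂ Virasoro L) (hk : 0 < k)
    (hc : ∀ v : L, ⁅c, v⁆ = θ • v) (hinj : ∀ n ∈ annihilatedAbove L k, ⁅l k, n⁆ = 0 → n = 0)
    {v : L} (hv : v ∈ annihilatedAbove L k) (h0 : v ≠ 0) :
    ∃ e : IndTheta (annihilatedAbove L k) θ ≃ₗ⁅ℂ, Virasoro⁆ L,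
      ∀ x : annihilatedAbove L k, e (IndTheta.oneTmul θ x) = (x : L) := by
  obtain ⟨φ, hφ⟩ := exists_indTheta_hom (annihilatedAbove L k) hc
  have hinjective : Function.Injective φ := by
    rw [injective_iff_map_eq_zero]
    intro m hm
    obtain ⟨F, hF, rfl⟩ := IndTheta.exists_evalMon_eq m
    have key := eq_zero_of_sum_eq_zero (N₀ := (annihilatedAbove L k).toSubmodule) hk hc
      l_lie_mem_annihilatedAbove_toSubmodule (fun i hi n hn => hn i hi) hinj
      (A := F.support) (f := fun s => ((F s : annihilatedAbove L k) : L)) hF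
      (fun s _ => (F s).2) ?_
    · rw [evalMon_apply]
      refine Finset.sum_eq_zero fun s hs => ?_
      rw [show F s = 0 from Subtype.ext (key s hs), map_zero, map_zero]
    · rw [evalMon_apply, map_sum] at hm
      rw [← hm]
      refine Finset.sum_congr rfl fun s _ => ?_
      rw [map_word, IndTheta.oneTmulₗ_apply, hφ]
  have hsurj : Function.Surjective φ := by
    have hrange : ∀ i : ℤ, ∀ w ∈ LinearMap.range φ.toLinearMap,
        ⁅l i, w⁆ ∈ LinearMap.range φ.toLinearMap := by
      rintro i _ ⟨m, rfl⟩
      exact ⟨⁅l i, m⁆, φ.map_lie _ _⟩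
    have hmem : v ∈ LinearMap.range φ.toLinearMap := ⟨IndTheta.oneTmul θ ⟨v, hv⟩, hφ _⟩
    exact LinearMap.range_eq_top.1 (eq_top_of_stable hL _ hrange hmem h0)
  let e : IndTheta (annihilatedAbove L k) θ ≃ₗ[ℂ] L :=
    LinearEquiv.ofBijective φ.toLinearMap ⟨hinjective, hsurj⟩
  exact ⟨{ φ with invFun := e.symm, left_inv := e.left_inv, right_inv := e.right_inv }, hφ⟩

end CanonicalHom

end Virasoro

/-! ### The main theorem -/

open Virasoro in
theorem theorem2 (L : Type u) [AddCommGroup L] [Module ℂ L] [LieRingModule Virasoro L]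
    [LieModule ℂ Virasoro L] (hL : LieModule.IsIrreducible ℂ Virasoro L) :
    List.TFAE
      [ -- (a) `L` is locally finite over some `𝔙₊⁽ᵏ⁾`
        ∃ k : ℕ, 0 < k ∧ IsLocallyFiniteModule (plusAbove k) L,
        -- (b) `L` is locally nilpotent over some `𝔙₊⁽ⁿ⁾`
        ∃ n : ℕ, 0 < n ∧ IsLocallyNilpotentModule (plusAbove n) L,
        -- (c) `L` is a highest weight module or is isomorphic to some `Ind_θ(N)`
        IsHighestWeightModule L ∨
          ∃ (θ : ℂ) (k : ℕ) (N : Type u) (_ : AddCommGroup N) (_ : Module ℂ N)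
            (_ : LieRingModule plus N) (_ : LieModule ℂ plus N),
            0 < k ∧ IsInducingModule k N ∧ Nonempty (L ≃ₗ⁅ℂ, Virasoro⁆ IndTheta N θ)] ∧
    -- under (b), if the least `k ≥ 0` such that all `l i`, `i > k`, act locally nilpotently on `L`
    -- is positive, then `N = {v : l i v = 0 for all i > k}` is as in (c) and the canonical map
    -- `Ind_θ(N) → L`, `1 ⊗ x ↦ x`, is an isomorphism, where `θ` is the scalar by which `c` acts
    ((∃ n : ℕ, 0 < n ∧ IsLocallyNilpotentModule (plusAbove n) L) →
      ∀ k : ℕ, 0 < k →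
        IsLeast {m : ℕ | ∀ i : ℤ, (m : ℤ) < i → ActsLocallyNilpotently (l i) L} k →
        IsInducingModule k (annihilatedAbove L k) ∧
        ∃ θ : ℂ, (∀ v : L, ⁅c, v⁆ = θ • v) ∧
          ∃ e : IndTheta (annihilatedAbove L k) θ ≃ₗ⁅ℂ, Virasoro⁆ L,
            ∀ x : annihilatedAbove L k, e (IndTheta.oneTmul θ x) = (x : L)) := by
  obtain ⟨v₀, hv₀⟩ := exists_ne_zero_of_isIrreducible hL
  obtain ⟨θ, hc⟩ := exists_central_character hL
  have hmain : (∃ n : ℕ, 0 < n ∧ IsLocallyNilpotentModule (plusAbove n) L) →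
      ∀ k : ℕ, 0 < k →
        IsLeast {m : ℕ | ∀ i : ℤ, (m : ℤ) < i → ActsLocallyNilpotently (l i) L} k →
        IsInducingModule k (annihilatedAbove L k) ∧
        ∃ θ : ℂ, (∀ v : L, ⁅c, v⁆ = θ • v) ∧
          ∃ e : IndTheta (annihilatedAbove L k) θ ≃ₗ⁅ℂ, Virasoro⁆ L,
            ∀ x : annihilatedAbove L k, e (IndTheta.oneTmul θ x) = (x : L) := by
    rintro ⟨n, -, hn⟩ k hk ⟨hkmem, hkmin⟩
    obtain ⟨w, hw, hw0⟩ := exists_mem_annihilatedAbove_of_isLocallyNilpotentModule hv₀ hn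
    obtain ⟨v, hv, hv0⟩ := exists_mem_annihilatedAbove_of_actsLocallyNilpotently hw hw0 hkmem
    have hinj : ∀ n ∈ annihilatedAbove L k, ⁅l k, n⁆ = 0 → n = 0 := by
      intro n hn hkn
      by_contra hn0
      -- A nonzero vector of `N` killed by `l k` would make all `l i` with `i > k - 1` locally
      -- nilpotent, against the minimality of `k`.
      have hn' : n ∈ annihilatedAbove L (k - 1) := fun i hi => by
        rcases (show i = k ∨ (k : ℤ) < i by lia) with rfl | h
        · exact hkn
        · exact hn i h
      have := hkmin fun i hi => actsLocallyNilpotently_of_mem hL hn' hn0 hi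
      lia
    refine ⟨⟨annihilatedAbove_isIrreducible hL hk hc hinj hv hv0, ?_, ?_⟩, θ, hc,
      exists_indTheta_equiv hL hk hc hinj hv hv0⟩
    · intro x y hxy
      have h1 : ⁅l k, (x : L)⁆ = ⁅l k, (y : L)⁆ := congrArg Subtype.val hxy
      refine Subtype.ext (sub_eq_zero.1 (hinj _ (sub_mem x.2 y.2) ?_))
      rw [lie_sub, h1, sub_self]
    · intro i hi x
      exact Subtype.ext (x.2 i (by lia))
  refine ⟨?_, hmain⟩
  tfae_have 1 → 2 := by
    rintro ⟨k, -, h⟩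
    obtain ⟨n, hn, hv⟩ := exists_mem_annihilatedAbove_of_isLocallyFiniteModule v₀ h
    exact ⟨n, hn, isLocallyNilpotentModule_of_mem hL hv hv₀⟩
  tfae_have 2 → 1 := by
    rintro ⟨n, hn, h⟩
    obtain ⟨w, hw, hw0⟩ := exists_mem_annihilatedAbove_of_isLocallyNilpotentModule hv₀ h
    exact ⟨n, hn, isLocallyFiniteModule_of_mem hL hw hw0⟩
  tfae_have 2 → 3 := by
    classical
    rintro ⟨n, hn, h⟩
    obtain ⟨w, hw, hw0⟩ := exists_mem_annihilatedAbove_of_isLocallyNilpotentModule hv₀ h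
    have hex : ∃ m : ℕ, ∀ i : ℤ, (m : ℤ) < i → ActsLocallyNilpotently (l i) L :=
      ⟨n, fun i hi => actsLocallyNilpotently_of_mem hL hw hw0 hi⟩
    have hleast : IsLeast {m : ℕ | ∀ i : ℤ, (m : ℤ) < i → ActsLocallyNilpotently (l i) L}
        (Nat.find hex) := ⟨Nat.find_spec hex, fun m hm => Nat.find_min' hex hm⟩
    rcases Nat.eq_zero_or_pos (Nat.find hex) with h0 | hpos
    · left
      have hspec := Nat.find_spec hex
      rw [h0] at hspec
      obtain ⟨v, hv, hv0⟩ := exists_mem_annihilatedAbove_of_actsLocallyNilpotently hw hw0 hspec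
      obtain ⟨a, x, hx, hx0, hax⟩ := exists_eigenvector_l_zero hL hc hv hv0
      refine ⟨a, θ, x, hx0, fun i hi => hx i (by simpa using hi), hax, hc x, ?_⟩
      refine (hL.eq_bot_or_eq_top _).resolve_left fun hbot => hx0 ?_
      have : x ∈ LieSubmodule.lieSpan ℂ Virasoro {x} := LieSubmodule.subset_lieSpan rfl
      rwa [hbot, LieSubmodule.mem_bot] at this
    · right
      obtain ⟨hind, θ', -, e, -⟩ := hmain ⟨n, hn, h⟩ _ hpos hleast
      exact ⟨θ', Nat.find hex, annihilatedAbove L (Nat.find hex), inferInstance, inferInstance,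
        inferInstance, inferInstance, hpos, hind, ⟨e.symm⟩⟩
  tfae_have 3 → 2 := by
    rintro (⟨h, z, v, hv0, hv, -, -, -⟩ | ⟨θ', k, N, _, _, _, _, hk, hN, ⟨e⟩⟩)
    · exact ⟨1, one_pos, isLocallyNilpotentModule_of_mem hL (v := v)
        (fun i hi => hv i (by push_cast at hi; lia)) hv0⟩
    · have hmem : ∀ x : N, e.symm (IndTheta.oneTmul θ' x) ∈ annihilatedAbove L k := by
        intro x i hi
        have h1 := hN.2.2 i.toNat (by lia) x
        have h2 := IndTheta.lie_oneTmul (θ := θ') (lPlus i.toNat) x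
        have h3 : ((lPlus i.toNat : plus) : Virasoro) = l i := by
          change l (i.toNat : ℤ) = l i
          rw [Int.toNat_of_nonneg (by lia)]
        rw [h1, h3, ← IndTheta.oneTmulₗ_apply 0, map_zero] at h2
        rw [← LieModuleEquiv.coe_toLieModuleHom, ← LieModuleHom.map_lie, h2, map_zero]
      -- The elements `1 ⊗ x` generate `Ind_θ(N)`, so they cannot all vanish when it is isomorphic
      -- to the nonzero `L`.
      by_cases hall : ∀ x : N, IndTheta.oneTmul θ' x = 0
      · have htop := IndTheta.eq_top_of_stable (N := N) (θ := θ') ⊥ (fun i w hw => by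
          rw [Submodule.mem_bot] at hw ⊢; rw [hw, lie_zero]) (fun x => (Submodule.mem_bot ℂ).2 (hall x))
        have : e v₀ ∈ (⊥ : Submodule ℂ (IndTheta N θ')) := by rw [htop]; trivial
        rw [Submodule.mem_bot] at this
        exact absurd (e.injective (this.trans (map_zero e.toLieModuleHom).symm)) hv₀
      · push Not at hall
        obtain ⟨x, hx⟩ := hall
        exact ⟨k, hk, isLocallyNilpotentModule_of_mem hL (hmem x) fun h =>
          hx (e.symm.injective (h.trans (map_zero e.symm.toLieModuleHom).symm))⟩
  tfae_finish
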